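/- Let $\mathcal L=\{H_i\}_{i\in I}$ and $\mathcal E=\{E_j\}_{j\in J}$ be partitions of the sure event $\Omega$ into nonempty events, with arbitrary index sets. For a set of events $\mathcal G$ let $\langle\mathcal G\rangle$ be the Boolean algebra it generates and $\langle\mathcal G\rangle^*$ the smallest Boolean algebra of events containing $\mathcal G$ and closed under arbitrary disjunctions and conjunctions. Let $\mathcal A_{\mathcal L},\mathcal A_{\mathcal E},\mathcal A$ be Boolean algebras of events with $\langle\mathcal L\rangle\subseteq\mathcal A_{\mathcal L}\subseteq\langle\mathcal L\rangle^*$, $\langle\mathcal E\rangle\subseteq\mathcal A_{\mathcal E}\subseteq\langle\mathcal E\rangle^*$ and $\langle\mathcal A_{\mathcal L}\cup\mathcal A_{\mathcal E}\rangle\subseteq\mathcal A\subseteq\langle\mathcal A_{\mathcal L}\cup\mathcal A_{\mathcal E}\rangle^*$, and put $\mathcal A^0=\mathcal A\setminus\{\emptyset\}$. A strategy is a map $\sigma:\mathcal A\times\mathcal L\to[0,1]$ such that, for every $i$, $\sigma(\cdot|H_i)$ is a finitely additive probability on $\mathcal A$ and $\sigma(F|H_i)=1$ whenever $F\wedge H_i=H_i$.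 Let $\sigma$ be a strategy and $\pi$ a finitely additive probability on $\mathcal A_{\mathcal L}$. A function $P:\mathcal G\to[0,1]$ on a set $\mathcal G$ of conditional events $E|H$ (with $H\neq\emptyset$) is a coherent conditional probability if for all $n\ge 1$, all $E_1|H_1,\dots,E_n|H_n\in\mathcal G$ and all real $s_1,\dots,s_n$, the gain $G=\sum_j s_j(\mathbf 1_{E_j}-P(E_j|H_j))\mathbf 1_{H_j}$ satisfies $\min G\le 0\le\max G$ over $H_1\vee\dots\vee H_n$. A full conditional probability (f.c.p.) on $\mathcal A$ is a map $P:\mathcal A\times\mathcal A^0\to[0,1]$ such that $P(E|H)=P(E\wedge H|H)$, $P(\cdot|H)$ is a finitely additive probability on $\mathcal A$, and $P(E\wedge F|H)=P(E|H)P(F|E\wedge H)$ whenever $H,E\wedge H\in\mathcal A^0$. Let $\mathbf P$ be the set of f.c.p.'s $\tilde P$ on $\mathcal A$ extending $\{\pi,\sigma\}$, i.e. with $\tilde P(\cdot|\Omega)=\pi$ on $\mathcal A_{\mathcal L}$ and $\tilde P(\cdot|H_i)=\sigma(\cdot|H_i)$ for all $i$, and let $\underline P(F|K)=\min_{\tilde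 P\in\mathbf P}\tilde P(F|K)$. Let $\mathbf P^{j}$ be the set of finitely additive probabilities $p$ on $\mathcal A$ with $p|_{\mathcal A_{\mathcal L}}=\pi$ such that $\{p,\sigma\}$ is a coherent conditional probability on $\mathcal A\times(\{\Omega\}\cup\mathcal L)$, and let $\underline P^{j}(F)=\min_{p\in\mathbf P^{j}}p(F)$, $\overline P^{j}(F)=\max_{p\in\mathbf P^{j}}p(F)$. For $F\in\mathcal A$, $K\in\mathcal A^0$ let $$L^{j}(F,K)=\min\{p(F\wedge K): p\in\mathbf P^{j},\ p(F^c\wedge K)=\overline P^{j}(F^c\wedge K)\},$$ $$U^{j}(F,K)=\max\{p(F\wedge K): p\in\mathbf P^{j},\ p(F^c\wedge K)=\underline P^{j}(F^c\wedge K)\},$$ $$I_2^{F|K}=\{i\in I: H_i\wedge F\wedge K\neq\emptyset\neq H_i\wedge F^c\wedge K\},\qquad I_3^{F|K}=\{i\in I: H_i\wedge F\wedge K=\emptyset\neq H_i\wedge F^c\wedge K\}.$$ Then all these minima and maxima are attained (in particular $\mathbf P$ and $\mathbf P^{j}$ are nonempty), and for all $F\in\mathcal A$ and $K\in\mathcal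 A^0$ one has $\underline P(F|K)=1$ if $F\wedge K=K$, while if $F\wedge K\neq K$: (i) if $\underline P^{j}(K)>0$, then $$\underline P(F|K)=\min\left\{\frac{\underline P^{j}(F\wedge K)}{\underline P^{j}(F\wedge K)+U^{j}(F^c,K)},\ \frac{L^{j}(F,K)}{L^{j}(F,K)+\overline P^{j}(F^c\wedge K)}\right\};$$ (ii) if $\underline P^{j}(K)=0$, then $$\underline P(F|K)=\min_{i\in I_2^{F|K}}\frac{\sigma(F\wedge K|H_i)}{\sigma(K|H_i)}$$ if $I_2^{F|K}\neq\emptyset=I_3^{F|K}$, $I_2^{F|K}$ is finite and $\sigma(K|H_i)>0$ for all $i\in I_2^{F|K}$, and $\underline P(F|K)=0$ otherwise. -/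

import Mathlib

/-!  Events are subsets of a sample space `Ω`; the sure event is `univ`, the impossible event is `∅`. -/

/-- The family `H` is a partition of the sure event into non-impossible events. -/
def IsPartition {Ω ι : Type*} (H : ι → Set Ω) : Prop :=
  (∀ i, (H i).Nonempty) ∧ Pairwise (fun i j => Disjoint (H i) (H j)) ∧ ⋃ i, H i = Set.univ

/-- The complete atomic Boolean algebra `⟨S⟩*` generated by a set `S` of events: the smallest
algebra of events that contains `S` and is closed under arbitrary disjunctions
(hence, taking complements, under arbitrary conjunctions). -/
def completeAlgebra {Ω : Type*} (S : Set (Set Ω)) : Set (Set Ω) :=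
  {X | ∀ B : BooleanSubalgebra (Set Ω), S ⊆ (B : Set (Set Ω)) →
    (∀ T : Set (Set Ω), T ⊆ (B : Set (Set Ω)) → ⋃₀ T ∈ B) → X ∈ B}

/-- `p` is a finitely additive probability on the algebra `A` (values off `A` are irrelevant). -/
structure IsFinAddProb {Ω : Type*} (A : BooleanSubalgebra (Set Ω)) (p : Set Ω → ℝ) : Prop where
  nonneg : ∀ E ∈ A, 0 ≤ p E
  univ_eq : p Set.univ = 1
  add : ∀ E ∈ A, ∀ F ∈ A, Disjoint E F → p (E ∪ F) = p E + p F

/-- `σ F (H i)` is the value `σ(F|H_i)` of a strategy on `A × {H_i}`. -/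
structure IsStrategy {Ω ι : Type*} (A : BooleanSubalgebra (Set Ω)) (H : ι → Set Ω)
    (σ : Set Ω → Set Ω → ℝ) : Prop where
  eq_one : ∀ i, ∀ F ∈ A, F ∩ H i = H i → σ F (H i) = 1
  finAdd : ∀ i, IsFinAddProb A (fun F => σ F (H i))

/-- The random gain of the bets with stakes `s j` on the conditional events `(e j).1 | (e j).2`,
when the assessment is `P`. -/
noncomputable def gain {Ω : Type*} (P : Set Ω → Set Ω → ℝ) {n : ℕ}
    (e : Fin n → Set Ω × Set Ω) (s : Fin n → ℝ) (ω : Ω) : ℝ :=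
  ∑ j, s j * ((e j).1.indicator (fun _ => (1 : ℝ)) ω - P (e j).1 (e j).2)
    * (e j).2.indicator (fun _ => (1 : ℝ)) ω

/-- `P` is a coherent conditional probability on the set `G` of conditional events `E|H`, written
as pairs `(E, H)`.  A gain takes finitely many values, so `min ≤ 0 ≤ max` over the disjunction
of the conditioning events says that it is `≤ 0` somewhere there and `≥ 0` somewhere there. -/
structure IsCoherent {Ω : Type*} (G : Set (Set Ω × Set Ω)) (P : Set Ω → Set Ω → ℝ) : Prop where
  cond_nonempty : ∀ e ∈ G, e.2.Nonempty
  mem_Icc : ∀ e ∈ G, P e.1 e.2 ∈ Set.Icc (0 : ℝ) 1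
  gain_bounds : ∀ (n : ℕ), 0 < n → ∀ (e : Fin n → Set Ω × Set Ω) (s : Fin n → ℝ),
    (∀ j, e j ∈ G) →
      (∃ ω ∈ ⋃ j, (e j).2, gain P e s ω ≤ 0) ∧ (∃ ω ∈ ⋃ j, (e j).2, 0 ≤ gain P e s ω)

/-- `P` is a full conditional probability on `A`, i.e. a conditional probability with domain
`A × (A \ {∅})`; `P E K` is the value `P(E|K)`. -/
structure IsFullCondProb {Ω : Type*} (A : BooleanSubalgebra (Set Ω))
    (P : Set Ω → Set Ω → ℝ) : Prop where
  inter_cond : ∀ E ∈ A, ∀ K ∈ A, K.Nonempty → P E K = P (E ∩ K) K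
  finAdd : ∀ K ∈ A, K.Nonempty → IsFinAddProb A (fun E => P E K)
  chain : ∀ E ∈ A, ∀ F ∈ A, ∀ K ∈ A, K.Nonempty → (E ∩ K).Nonempty →
    P (E ∩ F) K = P E K * P F (E ∩ K)

/-- The full conditional probabilities on `A` extending `{π, σ}`. -/
def fullExtensions {Ω ι : Type*} (A AL : BooleanSubalgebra (Set Ω)) (H : ι → Set Ω)
    (π : Set Ω → ℝ) (σ : Set Ω → Set Ω → ℝ) : Set (Set Ω → Set Ω → ℝ) :=
  {P | IsFullCondProb A P ∧ (∀ B ∈ AL, P B Set.univ = π B) ∧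
    ∀ F ∈ A, ∀ i, P F (H i) = σ F (H i)}

/-- The joint probabilities on `A` consistent with `{π, σ}`: finitely additive probabilities `p`
on `A` that restrict to `π` on `AL`, such that `{p, σ}` is a coherent conditional probability
`Q` on `A × ({Ω} ∪ {H_i})`. -/
def jointProbs {Ω ι : Type*} (A AL : BooleanSubalgebra (Set Ω)) (H : ι → Set Ω)
    (π : Set Ω → ℝ) (σ : Set Ω → Set Ω → ℝ) : Set (Set Ω → ℝ) :=
  {p | IsFinAddProb A p ∧ (∀ B ∈ AL, p B = π B) ∧
    ∃ Q : Set Ω → Set Ω → ℝ,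
      (∀ F ∈ A, Q F Set.univ = p F) ∧ (∀ F ∈ A, ∀ i, Q F (H i) = σ F (H i)) ∧
      IsCoherent ((A : Set (Set Ω)) ×ˢ ({Set.univ} ∪ Set.range H)) Q}

section envelopes

variable {Ω ι : Type*} (A AL : BooleanSubalgebra (Set Ω)) (H : ι → Set Ω)
  (π : Set Ω → ℝ) (σ : Set Ω → Set Ω → ℝ)

/-- The values `P(F|K)` of the full conditional probabilities extending `{π, σ}`. -/
def extensionValues (F K : Set Ω) : Set ℝ :=
  (fun P : Set Ω → Set Ω → ℝ => P F K) '' fullExtensions A AL H π σ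

/-- The lower envelope of the full conditional probabilities extending `{π, σ}`. -/
noncomputable def lowerEnvelope (F K : Set Ω) : ℝ :=
  sInf (extensionValues A AL H π σ F K)

/-- The values `p(F)` of the consistent joint probabilities. -/
def jointValues (F : Set Ω) : Set ℝ :=
  (fun p : Set Ω → ℝ => p F) '' jointProbs A AL H π σ

/-- The lower joint probability. -/
noncomputable def lowerJoint (F : Set Ω) : ℝ := sInf (jointValues A AL H π σ F)

/-- The upper joint probability. -/
noncomputable def upperJoint (F : Set Ω) : ℝ := sSup (jointValues A AL H π σ F)

/-- The values `p(F ∧ K)` of the consistent joint probabilities with maximal `p(Fᶜ ∧ K)`. -/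
def lowerAuxValues (F K : Set Ω) : Set ℝ :=
  (fun p : Set Ω → ℝ => p (F ∩ K)) ''
    {p | p ∈ jointProbs A AL H π σ ∧ p (Fᶜ ∩ K) = upperJoint A AL H π σ (Fᶜ ∩ K)}

/-- The values `p(F ∧ K)` of the consistent joint probabilities with minimal `p(Fᶜ ∧ K)`. -/
def upperAuxValues (F K : Set Ω) : Set ℝ :=
  (fun p : Set Ω → ℝ => p (F ∩ K)) ''
    {p | p ∈ jointProbs A AL H π σ ∧ p (Fᶜ ∩ K) = lowerJoint A AL H π σ (Fᶜ ∩ K)}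

/-- The function `L(F, K)`. -/
noncomputable def lowerAux (F K : Set Ω) : ℝ := sInf (lowerAuxValues A AL H π σ F K)

/-- The function `U(F, K)`. -/
noncomputable def upperAux (F K : Set Ω) : ℝ := sSup (upperAuxValues A AL H π σ F K)

end envelopes

/-- The indices `i` for which `H i` meets both `F ∧ K` and `Fᶜ ∧ K`. -/
def indexTwo {Ω ι : Type*} (H : ι → Set Ω) (F K : Set Ω) : Set ι :=
  {i | H i ∩ F ∩ K ≠ ∅ ∧ H i ∩ Fᶜ ∩ K ≠ ∅}

/-- The indices `i` for which `H i` meets `Fᶜ ∧ K` but not `F ∧ K`. -/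
def indexThree {Ω ι : Type*} (H : ι → Set Ω) (F K : Set Ω) : Set ι :=
  {i | H i ∩ F ∩ K = ∅ ∧ H i ∩ Fᶜ ∩ K ≠ ∅}

/-!
By the product rule, the joint probabilities consistent with `{π, σ}` are the finitely additive
extensions `p` of `π` with `p(F ∧ H_i) = σ(F|H_i) p(H_i)`. Given disjoint events `X` and `Y`, on
each atom of a finite subalgebra of `A_L` that is not a cell `H_i` put a point mass outside `X`,
and inside `Y`, whenever this is possible; on cells use `σ`. An ultrafilter limit over these
subalgebras is a consistent joint probability that minimizes the mass of `X` and maximizes that of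
`Y` simultaneously. With `X = F ∧ K` and `Y = Fᶜ ∧ K` this yields `L(F, K)` and `U(Fᶜ, K)`, and,
when the lower probability of `K` is positive, minimizes `P(F|K) = p(F ∧ K) / p(K)`.

A full conditional probability arises from a well-ordered family of layers that charges every
possible event: condition on `K` inside the first layer that charges `K`. Taking as layers a
consistent joint probability, then finitely many chosen ones, then the probabilities `σ(·|H_i)`,
then all point masses gives an extension of `{π, σ}`. If the first layer vanishes on `K`, the
chosen layers determine `P(·|K)`: the value is one of the ratios `σ(F ∧ K|H_i) / σ(K|H_i)`, or zero
by means of a point mass in `H_i ∧ Fᶜ ∧ K` placed after `σ(·|H_i)`, or zero by means of an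
ultrafilter on `Fᶜ ∧ K` null on every cell if infinitely many cells meet `Fᶜ ∧ K`. Conversely, if
`Fᶜ ∧ K` is covered by finitely many cells, finite conglomerability bounds `P(Fᶜ|K)` by the largest
of the `P(Fᶜ|H_i ∧ K)`.
-/

section Algebra

variable {Ω : Type*} {A : BooleanSubalgebra (Set Ω)} {E F : Set Ω}

theorem univ_mem_algebra : Set.univ ∈ A := A.top_mem

theorem inter_mem_algebra (hE : E ∈ A) (hF : F ∈ A) : E ∩ F ∈ A := A.infClosed hE hF

theorem union_mem_algebra (hE : E ∈ A) (hF : F ∈ A) : E ∪ F ∈ A := A.supClosed hE hF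

theorem diff_mem_algebra (hE : E ∈ A) (hF : F ∈ A) : E \ F ∈ A := A.sdiff_mem hE hF

theorem biUnion_mem_algebra {α : Type*} {s : Finset α} {X : α → Set Ω} (hX : ∀ a ∈ s, X a ∈ A) :
    ⋃ a ∈ s, X a ∈ A := by
  rw [← Finset.sup_set_eq_biUnion]
  exact Finset.sup_mem _ A.bot_mem (fun _ hE _ hF ↦ union_mem_algebra hE hF) s X hX

end Algebra

namespace IsFinAddProb

variable {Ω : Type*} {A : BooleanSubalgebra (Set Ω)} {p : Set Ω → ℝ} {E F : Set Ω}

theorem inter_add_diff (hp : IsFinAddProb A p) (hE : E ∈ A) (hF : F ∈ A) :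
    p (E ∩ F) + p (E \ F) = p E := by
  rw [← hp.add _ (inter_mem_algebra hE hF) _ (diff_mem_algebra hE hF)
    Set.disjoint_sdiff_inter.symm, Set.inter_union_sdiff]

theorem empty (hp : IsFinAddProb A p) : p ∅ = 0 := by
  have h := hp.inter_add_diff (A.bot_mem) (A.bot_mem)
  simpa using h

theorem nonempty_of_eq_one (hp : IsFinAddProb A p) (hE1 : p E = 1) : E.Nonempty := by
  rw [Set.nonempty_iff_ne_empty]
  rintro rfl
  exact zero_ne_one (hp.empty.symm.trans hE1)

theorem mono (hp : IsFinAddProb A p) (hE : E ∈ A) (hF : F ∈ A) (h : E ⊆ F) : p E ≤ p F := by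
  have hsplit := hp.inter_add_diff hF hE
  rw [Set.inter_eq_right.2 h] at hsplit
  linarith [hp.nonneg _ (diff_mem_algebra hF hE)]

theorem le_one (hp : IsFinAddProb A p) (hE : E ∈ A) : p E ≤ 1 :=
  hp.univ_eq ▸ hp.mono hE univ_mem_algebra (Set.subset_univ E)

theorem compl (hp : IsFinAddProb A p) (hE : E ∈ A) : p Eᶜ = 1 - p E := by
  have h := hp.inter_add_diff univ_mem_algebra hE
  rw [Set.univ_inter, ← Set.compl_eq_univ_sdiff, hp.univ_eq] at h
  linarith

theorem inter_add_compl_inter (hp : IsFinAddProb A p) (hE : E ∈ A) (hF : F ∈ A) :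
    p (E ∩ F) + p (Eᶜ ∩ F) = p F := by
  rw [Set.inter_comm E, Set.inter_comm Eᶜ, ← Set.sdiff_eq, hp.inter_add_diff hF hE]

theorem eq_zero_of_subset (hp : IsFinAddProb A p) (hE : E ∈ A) (hF : F ∈ A) (h : E ⊆ F)
    (hF0 : p F = 0) : p E = 0 :=
  le_antisymm (hF0 ▸ hp.mono hE hF h) (hp.nonneg E hE)

theorem eq_zero_of_disjoint (hp : IsFinAddProb A p) (hE : E ∈ A) (hF : F ∈ A)
    (h : Disjoint E F) (hF1 : p F = 1) : p E = 0 :=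
  hp.eq_zero_of_subset hE (A.compl_mem hF) h.subset_compl_right (by rw [hp.compl hF, hF1, sub_self])

theorem inter_eq_of_eq_one (hp : IsFinAddProb A p) (hE : E ∈ A) (hF : F ∈ A) (hF1 : p F = 1) :
    p (E ∩ F) = p E := by
  rw [← hp.inter_add_diff hE hF, left_eq_add]
  exact hp.eq_zero_of_disjoint (diff_mem_algebra hE hF) hF Set.disjoint_sdiff_left hF1

theorem biUnion (hp : IsFinAddProb A p) {α : Type*} {s : Finset α} {X : α → Set Ω}
    (hX : ∀ a ∈ s, X a ∈ A) (hd : (s : Set α).PairwiseDisjoint X) :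
    p (⋃ a ∈ s, X a) = ∑ a ∈ s, p (X a) := by
  classical
  induction s using Finset.induction_on with
  | empty => simpa using hp.empty
  | insert a s ha ih =>
    rw [Finset.forall_mem_insert] at hX
    have hdisj : Disjoint (X a) (⋃ b ∈ s, X b) := by
      refine Set.disjoint_iUnion₂_right.2 fun b hb ↦ hd (by simp) (by simp [hb]) ?_
      rintro rfl
      exact ha hb
    rw [Finset.set_biUnion_insert, Finset.sum_insert ha,
      hp.add _ hX.1 _ (biUnion_mem_algebra hX.2) hdisj, ih hX.2 (hd.subset (by simp))]

end IsFinAddProb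

section UltrafilterMass

variable {Ω : Type*} {U : Ultrafilter Ω} {E : Set Ω}

open Classical in
/-- The `0`-`1` valued finitely additive probability of an ultrafilter. Point masses are the case
of principal ultrafilters. -/
noncomputable def ultrafilterMass (U : Ultrafilter Ω) (E : Set Ω) : ℝ := if E ∈ U then 1 else 0

theorem ultrafilterMass_eq_one (h : E ∈ U) : ultrafilterMass U E = 1 := if_pos h

theorem ultrafilterMass_eq_zero (h : E ∉ U) : ultrafilterMass U E = 0 := if_neg h

theorem ultrafilterMass_pure (ω : Ω) :
    ultrafilterMass (pure ω) E = E.indicator (fun _ ↦ (1 : ℝ)) ω := by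
  classical
  simp only [ultrafilterMass, Ultrafilter.mem_pure, Set.indicator_apply]

theorem isFinAddProb_ultrafilterMass (A : BooleanSubalgebra (Set Ω)) (U : Ultrafilter Ω) :
    IsFinAddProb A (ultrafilterMass U) where
  nonneg E _ := by unfold ultrafilterMass; positivity
  univ_eq := ultrafilterMass_eq_one Filter.univ_mem
  add E _ F _ hd := by
    have hEF : ¬ (E ∈ U ∧ F ∈ U) := fun h ↦
      U.empty_notMem (Set.disjoint_iff_inter_eq_empty.1 hd ▸ Filter.inter_mem h.1 h.2)
    by_cases hE : E ∈ U <;> by_cases hF : F ∈ U <;>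
      simp_all [ultrafilterMass, Ultrafilter.union_mem_iff]

end UltrafilterMass

section Mixture

variable {Ω : Type*} {A B : BooleanSubalgebra (Set Ω)}

/-- The atom of the algebra generated by the finite family `T` whose points lie, among the events
of `T`, exactly in those belonging to `c`. -/
def atomOf (T c : Finset B) : Set Ω := {ω | ∀ E ∈ T, ω ∈ (E : Set Ω) ↔ E ∈ c}

theorem atomOf_mem (T c : Finset B) : atomOf T c ∈ B := by
  classical
  have h : atomOf T c = (⋃ E ∈ T, if E ∈ c then (E : Set Ω)ᶜ else E)ᶜ := by
    ext ω
    simp only [atomOf, Set.mem_ofPred_eq, Set.mem_compl_iff, Set.mem_iUnion, not_exists]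
    refine forall₂_congr fun E _ ↦ ?_
    split_ifs <;> simp_all
  rw [h]
  refine B.compl_mem (biUnion_mem_algebra fun E _ ↦ ?_)
  split_ifs
  exacts [B.compl_mem E.2, E.2]

theorem atomOf_subset_or_disjoint {T : Finset B} (c : Finset B) {E : B} (hE : E ∈ T) :
    atomOf T c ⊆ E ∨ Disjoint (atomOf T c) E := by
  by_cases hc : E ∈ c
  · exact .inl fun ω hω ↦ (hω E hE).2 hc
  · exact .inr (Set.disjoint_left.2 fun ω hω h ↦ hc ((hω E hE).1 h))

theorem pairwiseDisjoint_atomOf (T : Finset B) :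
    (T.powerset : Set (Finset B)).PairwiseDisjoint (atomOf T) := by
  intro c hc d hd hcd
  refine Set.disjoint_left.2 fun ω hωc hωd ↦ hcd ?_
  rw [Finset.mem_coe, Finset.mem_powerset] at hc hd
  exact Finset.Subset.antisymm (fun E hE ↦ (hωd E (hc hE)).1 ((hωc E (hc hE)).2 hE))
    (fun E hE ↦ (hωc E (hd hE)).1 ((hωd E (hd hE)).2 hE))

theorem biUnion_atomOf (T : Finset B) : ⋃ c ∈ T.powerset, atomOf T c = Set.univ := by
  classical
  refine Set.eq_univ_of_forall fun ω ↦ ?_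
  exact Set.mem_biUnion (Finset.mem_powerset.2 (Finset.filter_subset (ω ∈ ·.1) T))
    fun E hE ↦ by simp [hE]

theorem IsFinAddProb.sum_inter_atomOf {p : Set Ω → ℝ} (hp : IsFinAddProb A p) (hBA : B ≤ A)
    (T : Finset B) {F : Set Ω} (hF : F ∈ A) :
    ∑ c ∈ T.powerset, p (F ∩ atomOf T c) = p F := by
  rw [← hp.biUnion (fun c _ ↦ inter_mem_algebra hF (hBA (atomOf_mem T c)))
    fun c hc d hd hcd ↦ (pairwiseDisjoint_atomOf T hc hd hcd).mono Set.inter_subset_right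
      Set.inter_subset_right, ← Set.inter_iUnion₂, biUnion_atomOf, Set.inter_univ]

/-- `κ` assigns to every event a finitely additive probability on `A`, which gives mass one to the
event when it is possible. -/
structure IsConcentratedKernel (A : BooleanSubalgebra (Set Ω)) (κ : Set Ω → Set Ω → ℝ) :
    Prop where
  finAdd : ∀ C, IsFinAddProb A (κ C)
  self : ∀ C, C.Nonempty → κ C C = 1

theorem isConcentratedKernel_ultrafilterMass {pt : Set Ω → Ω} (hpt : ∀ C, C.Nonempty → pt C ∈ C) :
    IsConcentratedKernel A fun C ↦ ultrafilterMass (pure (pt C)) where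
  finAdd _ := isFinAddProb_ultrafilterMass A _
  self C hC := ultrafilterMass_eq_one (hpt C hC)

/-- The average of the probabilities `κ C` over the atoms `C` generated by `T`, weighted by `p`. -/
noncomputable def mixture (T : Finset B) (p : Set Ω → ℝ) (κ : Set Ω → Set Ω → ℝ) (F : Set Ω) : ℝ :=
  ∑ c ∈ T.powerset, p (atomOf T c) * κ (atomOf T c) F

variable {p : Set Ω → ℝ} {κ : Set Ω → Set Ω → ℝ}

theorem isFinAddProb_mixture (hp : IsFinAddProb B p) (hκ : ∀ C, IsFinAddProb A (κ C))
    (T : Finset B) : IsFinAddProb A (mixture T p κ) where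
  nonneg F hF := Finset.sum_nonneg fun c _ ↦
    mul_nonneg (hp.nonneg _ (atomOf_mem T c)) ((hκ _).nonneg F hF)
  univ_eq := by
    simpa [mixture, (hκ _).univ_eq, hp.univ_eq] using
      hp.sum_inter_atomOf le_rfl T univ_mem_algebra
  add E hE F hF hd := by
    simp only [mixture, (hκ _).add E hE F hF hd, mul_add, Finset.sum_add_distrib]

theorem mixture_eq (hp : IsFinAddProb B p) (hκ : IsConcentratedKernel A κ) (hBA : B ≤ A)
    {T : Finset B} {E : B} (hE : E ∈ T) : mixture T p κ E = p E := by
  rw [← hp.sum_inter_atomOf le_rfl T E.2, mixture]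
  refine Finset.sum_congr rfl fun c _ ↦ ?_
  obtain hC | hC := (atomOf T c).eq_empty_or_nonempty
  · simp [hC, hp.empty]
  have hEA : (E : Set Ω) ∈ A := hBA E.2
  have hCA : atomOf T c ∈ A := hBA (atomOf_mem T c)
  obtain hsub | hdisj := atomOf_subset_or_disjoint c hE
  · have hone : κ (atomOf T c) E = 1 := le_antisymm ((hκ.finAdd _).le_one hEA)
      (hκ.self _ hC ▸ (hκ.finAdd _).mono hCA hEA hsub)
    rw [hone, mul_one, Set.inter_eq_right.2 hsub]
  · rw [(hκ.finAdd _).eq_zero_of_disjoint hEA hCA hdisj.symm (hκ.self _ hC), mul_zero,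
      hdisj.symm.inter_eq, hp.empty]

end Mixture

section Coherence

variable {Ω : Type*} {A : BooleanSubalgebra (Set Ω)} {m : Set Ω → ℝ}

theorem IsFinAddProb.exists_eq_sum_indicator (hm : IsFinAddProb A m) (T : Finset A) :
    ∃ x : Finset A → Ω, ∀ E ∈ T, m E = ∑ c ∈ T.powerset, m (atomOf T c) *
      (E : Set Ω).indicator (fun _ ↦ (1 : ℝ)) (x c) := by
  have : Nonempty Ω := (hm.nonempty_of_eq_one hm.univ_eq).to_type
  let pt : Set Ω → Ω := fun C ↦ Classical.epsilon (· ∈ C)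
  refine ⟨fun c ↦ pt (atomOf T c), fun E hE ↦ ?_⟩
  simp only [← ultrafilterMass_pure]
  exact (mixture_eq hm (isConcentratedKernel_ultrafilterMass (pt := pt)
    fun C ↦ Classical.epsilon_spec) le_rfl hE).symm

variable {G : Set (Set Ω × Set Ω)} {Q : Set Ω → Set Ω → ℝ} {n : ℕ} {e : Fin n → Set Ω × Set Ω}
  {s : Fin n → ℝ}

theorem gain_eq_sum_indicator_inter (ω : Ω) :
    gain Q e s ω = ∑ j, s j * (((e j).1 ∩ (e j).2).indicator (fun _ ↦ (1 : ℝ)) ω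
      - Q (e j).1 (e j).2 * (e j).2.indicator (fun _ ↦ (1 : ℝ)) ω) := by
  refine Finset.sum_congr rfl fun j _ ↦ ?_
  by_cases h1 : ω ∈ (e j).1 <;> by_cases h2 : ω ∈ (e j).2 <;> simp [h1, h2]

theorem gain_neg (ω : Ω) : gain Q e (-s) ω = -gain Q e s ω := by
  simp [gain]

theorem gain_eq_zero {ω : Ω} (hω : ω ∉ ⋃ j, (e j).2) : gain Q e s ω = 0 := by
  rw [Set.mem_iUnion, not_exists] at hω
  simp [gain, hω]

theorem IsFinAddProb.exists_gain_nonpos (hm : IsFinAddProb A m)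
    (he : ∀ j, (e j).1 ∈ A ∧ (e j).2 ∈ A)
    (hQ : ∀ j, m ((e j).1 ∩ (e j).2) = Q (e j).1 (e j).2 * m (e j).2)
    {k : Fin n} (hk : m (e k).2 = 1) : ∃ ω ∈ ⋃ j, (e j).2, gain Q e s ω ≤ 0 := by
  classical
  let B : Fin n → A := fun j ↦ ⟨_, inter_mem_algebra (he j).1 (he j).2⟩
  let C : Fin n → A := fun j ↦ ⟨_, (he j).2⟩
  obtain ⟨x, hx⟩ := hm.exists_eq_sum_indicator (Finset.univ.image B ∪ Finset.univ.image C)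
  set T := Finset.univ.image B ∪ Finset.univ.image C
  have hB (j) := hx (B j) (by simp [T])
  have hC (j) := hx (C j) (by simp [T])
  have hmean : ∑ c ∈ T.powerset, m (atomOf T c) * gain Q e s (x c) = 0 := by
    calc ∑ c ∈ T.powerset, m (atomOf T c) * gain Q e s (x c)
        = ∑ j, s j * (m (B j) - Q (e j).1 (e j).2 * m (C j)) := by
          simp only [gain_eq_sum_indicator_inter, hB, hC, Finset.mul_sum, ← Finset.sum_sub_distrib]
          rw [Finset.sum_comm]
          refine Finset.sum_congr rfl fun j _ ↦ Finset.sum_congr rfl fun c _ ↦ ?_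
          ring
      _ = 0 := Finset.sum_eq_zero fun j _ ↦ by rw [hQ j, sub_self, mul_zero]
  by_contra! hpos
  have hnonneg : ∀ ω, 0 ≤ gain Q e s ω := fun ω ↦
    if hω : ω ∈ ⋃ j, (e j).2 then (hpos ω hω).le else (gain_eq_zero hω).ge
  have hterm := (Finset.sum_eq_zero_iff_of_nonneg fun c _ ↦
    mul_nonneg (hm.nonneg _ (atomOf_mem T c)) (hnonneg (x c))).1 hmean
  refine one_ne_zero (hk.symm.trans ((hC k).trans (Finset.sum_eq_zero fun c hc ↦ ?_)))
  by_cases hxc : x c ∈ (e k).2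
  · have hgain := hpos (x c) (Set.mem_iUnion_of_mem k hxc)
    rw [(mul_eq_zero_iff_right hgain.ne').1 (hterm c hc), zero_mul]
  · rw [Set.indicator_of_notMem hxc, mul_zero]

theorem isCoherent_of_exists_isFinAddProb (hG : ∀ e ∈ G, e.1 ∈ A ∧ e.2 ∈ A)
    (h : ∀ n, 0 < n → ∀ e : Fin n → Set Ω × Set Ω, (∀ j, e j ∈ G) → ∃ m, IsFinAddProb A m ∧
      (∃ k, m (e k).2 = 1) ∧ ∀ j, m ((e j).1 ∩ (e j).2) = Q (e j).1 (e j).2 * m (e j).2) :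
    IsCoherent G Q where
  cond_nonempty e he := by
    obtain ⟨m, hm, ⟨_, hk⟩, -⟩ := h 1 one_pos (fun _ ↦ e) fun _ ↦ he
    exact hm.nonempty_of_eq_one hk
  mem_Icc e he := by
    obtain ⟨m, hm, ⟨_, hk⟩, hQ⟩ := h 1 one_pos (fun _ ↦ e) fun _ ↦ he
    have hQe := hQ 0
    rw [hk, mul_one] at hQe
    have hmem := inter_mem_algebra (hG e he).1 (hG e he).2
    exact hQe ▸ ⟨hm.nonneg _ hmem, hm.le_one hmem⟩
  gain_bounds n hn e s he := by
    obtain ⟨m, hm, ⟨k, hk⟩, hQ⟩ := h n hn e he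
    have hA := fun j ↦ hG _ (he j)
    obtain ⟨ω, hω, hle⟩ := hm.exists_gain_nonpos (s := -s) hA hQ hk
    rw [gain_neg, neg_nonpos] at hle
    exact ⟨hm.exists_gain_nonpos hA hQ hk, ω, hω, hle⟩

theorem IsCoherent.inter_eq_mul (hQ : IsCoherent G Q) {F K : Set Ω}
    (hFK : (F ∩ K, Set.univ) ∈ G) (hK : (K, Set.univ) ∈ G) (hF : (F, K) ∈ G) :
    Q (F ∩ K) Set.univ = Q F K * Q K Set.univ := by
  -- These stakes make the gain constant, so coherence forces that constant to vanish.
  have hgain : ∀ ω, gain Q ![(F ∩ K, Set.univ), (K, Set.univ), (F, K)] ![1, -Q F K, -1] ω =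
      Q F K * Q K Set.univ - Q (F ∩ K) Set.univ := by
    intro ω
    simp only [gain, Fin.sum_univ_three, Matrix.cons_val_zero, Matrix.cons_val_one,
      Matrix.cons_val]
    by_cases hωF : ω ∈ F <;> by_cases hωK : ω ∈ K <;> simp [hωF, hωK] <;> ring
  obtain ⟨⟨ω, _, hle⟩, ⟨ω', _, hge⟩⟩ := hQ.gain_bounds 3 (by norm_num)
    ![(F ∩ K, Set.univ), (K, Set.univ), (F, K)] ![1, -Q F K, -1]
    (by simp [Fin.forall_fin_succ, hFK, hK, hF])
  rw [hgain] at hle hge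
  linarith

end Coherence

section Strategy

variable {Ω ι : Type*} {A : BooleanSubalgebra (Set Ω)} {H : ι → Set Ω} {m : Set Ω → ℝ}
  {σ : Set Ω → Set Ω → ℝ} {F : Set Ω} {i : ι}

theorem IsStrategy.self (hσ : IsStrategy A H σ) (hi : H i ∈ A) : σ (H i) (H i) = 1 :=
  hσ.eq_one i _ hi (Set.inter_self _)

theorem IsStrategy.eq_zero_of_disjoint (hσ : IsStrategy A H σ) (hi : H i ∈ A) (hF : F ∈ A)
    (h : Disjoint F (H i)) : σ F (H i) = 0 :=
  (hσ.finAdd i).eq_zero_of_disjoint hF hi h (hσ.self hi)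

/-- `m` satisfies the product rule with respect to the conditional probabilities `σ(·|H_i)` on `A`
(it is disintegrable along the partition, cell by cell). -/
def IsDisintegrated (A : BooleanSubalgebra (Set Ω)) (H : ι → Set Ω) (σ : Set Ω → Set Ω → ℝ)
    (m : Set Ω → ℝ) : Prop :=
  ∀ F ∈ A, ∀ i, m (F ∩ H i) = σ F (H i) * m (H i)

theorem IsStrategy.isDisintegrated (hσ : IsStrategy A H σ) (hH : ∀ i, H i ∈ A)
    (hd : Pairwise fun i j ↦ Disjoint (H i) (H j)) (j : ι) :
    IsDisintegrated A H σ fun F ↦ σ F (H j) := by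
  intro F hF i
  beta_reduce
  obtain rfl | hij := eq_or_ne i j
  · rw [(hσ.finAdd i).inter_eq_of_eq_one hF (hH i) (hσ.self (hH i)), hσ.self (hH i), mul_one]
  · rw [hσ.eq_zero_of_disjoint (hH j) (inter_mem_algebra hF (hH i))
      ((hd hij).mono_left Set.inter_subset_right),
      hσ.eq_zero_of_disjoint (hH j) (hH i) (hd hij), mul_zero]

theorem IsFinAddProb.isDisintegrated_of_eq_zero (hm : IsFinAddProb A m) (hH : ∀ i, H i ∈ A)
    (h0 : ∀ i, m (H i) = 0) : IsDisintegrated A H σ m := fun F hF i ↦ by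
  rw [h0, mul_zero, hm.eq_zero_of_subset (inter_mem_algebra hF (hH i)) (hH i)
    Set.inter_subset_right (h0 i)]

end Strategy

/-- `H` is a partition of the sure event into atoms of the algebra `AL`. -/
structure IsAtomicPartition {Ω ι : Type*} (AL : BooleanSubalgebra (Set Ω)) (H : ι → Set Ω) :
    Prop where
  isPartition : IsPartition H
  mem : ∀ i, H i ∈ AL
  subset_or_disjoint : ∀ B ∈ AL, ∀ i, H i ⊆ B ∨ Disjoint (H i) B

/-- The data of the inference problem: a finitely additive probability `π` on an algebra `AL` whose
atoms `H i` form a partition, and a strategy `σ` on a larger algebra `A`. -/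
structure IsPriorStrategy {Ω ι : Type*} (A AL : BooleanSubalgebra (Set Ω)) (H : ι → Set Ω)
    (π : Set Ω → ℝ) (σ : Set Ω → Set Ω → ℝ) : Prop extends IsAtomicPartition AL H where
  le : AL ≤ A
  prior : IsFinAddProb AL π
  strategy : IsStrategy A H σ

/-- `p` is a finitely additive probability on `A` that extends `π` and is disintegrated by `σ`.
These are exactly the joint probabilities consistent with `{π, σ}`. -/
structure IsJoint {Ω ι : Type*} (A AL : BooleanSubalgebra (Set Ω)) (H : ι → Set Ω)
    (π : Set Ω → ℝ) (σ : Set Ω → Set Ω → ℝ) (p : Set Ω → ℝ) : Prop where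
  finAdd : IsFinAddProb A p
  eq_prior : ∀ B ∈ AL, p B = π B
  isDisintegrated : IsDisintegrated A H σ p

section Joint

variable {Ω ι : Type*} {A AL : BooleanSubalgebra (Set Ω)} {H : ι → Set Ω} {π p : Set Ω → ℝ}
  {σ : Set Ω → Set Ω → ℝ}

namespace IsAtomicPartition

theorem exists_mem (hH : IsAtomicPartition AL H) (ω : Ω) : ∃ i, ω ∈ H i :=
  Set.mem_iUnion.1 (hH.isPartition.2.2 ▸ Set.mem_univ ω)

theorem eq_of_mem (hH : IsAtomicPartition AL H) {i j : ι} {ω : Ω} (hi : ω ∈ H i)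
    (hj : ω ∈ H j) : i = j :=
  hH.isPartition.2.1.eq (Set.not_disjoint_iff.2 ⟨ω, hi, hj⟩)

end IsAtomicPartition

namespace IsPriorStrategy

variable (h : IsPriorStrategy A AL H π σ)
include h

theorem cell_mem (i : ι) : H i ∈ A := h.le (h.mem i)

theorem strategy_self (i : ι) : σ (H i) (H i) = 1 := h.strategy.self (h.cell_mem i)

theorem isDisintegrated_strategy (i : ι) : IsDisintegrated A H σ fun F ↦ σ F (H i) :=
  h.strategy.isDisintegrated h.cell_mem h.isPartition.2.1 i

theorem isJoint_of_mem_jointProbs (hp : p ∈ jointProbs A AL H π σ) : IsJoint A AL H π σ p := by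
  obtain ⟨hpA, hpAL, Q, hQp, hQσ, hQ⟩ := hp
  refine ⟨hpA, hpAL, fun F hF i ↦ ?_⟩
  have hFi := inter_mem_algebra hF (h.cell_mem i)
  rw [← hQp _ hFi, ← hQp _ (h.cell_mem i), ← hQσ F hF i]
  exact hQ.inter_eq_mul ⟨hFi, .inl rfl⟩ ⟨h.cell_mem i, .inl rfl⟩ ⟨hF, .inr ⟨i, rfl⟩⟩

theorem isCoherent (hp : IsJoint A AL H π σ p) {Q : Set Ω → Set Ω → ℝ}
    (hQp : ∀ F ∈ A, Q F Set.univ = p F) (hQσ : ∀ F ∈ A, ∀ i, Q F (H i) = σ F (H i)) :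
    IsCoherent ((A : Set (Set Ω)) ×ˢ ({Set.univ} ∪ Set.range H)) Q := by
  refine isCoherent_of_exists_isFinAddProb (A := A) ?_ fun n hn e he ↦ ?_
  · rintro ⟨F, K⟩ ⟨hF, rfl | ⟨i, rfl⟩⟩
    exacts [⟨hF, univ_mem_algebra⟩, ⟨hF, h.cell_mem i⟩]
  by_cases huniv : ∃ k, (e k).2 = Set.univ
  · obtain ⟨k, hk⟩ := huniv
    refine ⟨p, hp.finAdd, ⟨k, hk ▸ hp.finAdd.univ_eq⟩, fun j ↦ ?_⟩
    obtain ⟨hF, hK | ⟨i, hi⟩⟩ := he j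
    · rw [Set.mem_singleton_iff.1 hK, hQp _ hF, Set.inter_univ, hp.finAdd.univ_eq, mul_one]
    · rw [← hi, hQσ _ hF, hp.isDisintegrated _ hF]
  · have hcell (j) : ∃ i, H i = (e j).2 := (he j).2.resolve_left fun hj ↦ huniv ⟨j, hj⟩
    obtain ⟨i, hi⟩ := hcell ⟨0, hn⟩
    refine ⟨_, h.strategy.finAdd i, ⟨⟨0, hn⟩, hi ▸ h.strategy_self i⟩, fun j ↦ ?_⟩
    obtain ⟨i', hi'⟩ := hcell j
    rw [← hi', hQσ _ (he j).1]
    exact h.isDisintegrated_strategy i _ (he j).1 i'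

theorem mem_jointProbs_iff : p ∈ jointProbs A AL H π σ ↔ IsJoint A AL H π σ p := by
  classical
  refine ⟨h.isJoint_of_mem_jointProbs, fun hp ↦ ?_⟩
  let Q : Set Ω → Set Ω → ℝ := fun F K ↦ if K = Set.univ then p F else σ F K
  have hQp (F) : Q F Set.univ = p F := if_pos rfl
  have hQσ : ∀ F ∈ A, ∀ i, Q F (H i) = σ F (H i) := by
    intro F hF i
    by_cases hi : H i = Set.univ
    · have hprod := hp.isDisintegrated F hF i
      rwa [hi, Set.inter_univ, hp.finAdd.univ_eq, mul_one, ← hQp F, ← hi] at hprod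
    · exact if_neg hi
  exact ⟨hp.finAdd, hp.eq_prior, Q, fun F _ ↦ hQp F, hQσ, h.isCoherent hp (fun F _ ↦ hQp F) hQσ⟩

end IsPriorStrategy

end Joint

section MinimalJoint

theorem exists_isFinAddProb_tendsto {Ω D : Type*} {A : BooleanSubalgebra (Set Ω)}
    (U : Ultrafilter D) {μ : D → Set Ω → ℝ} (hμ : ∀ d, IsFinAddProb A (μ d)) :
    ∃ p, IsFinAddProb A p ∧ ∀ F ∈ A, Filter.Tendsto (μ · F) U (nhds (p F)) := by
  have hlim : ∀ F ∈ A, Filter.Tendsto (μ · F) U (nhds (Filter.limUnder U (μ · F))) := by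
    intro F hF
    obtain ⟨x, -, hx⟩ := isCompact_Icc.ultrafilter_le_nhds (U.map (μ · F))
      (Filter.tendsto_principal.2 (.of_forall fun d ↦ ⟨(hμ d).nonneg F hF, (hμ d).le_one hF⟩))
    exact tendsto_nhds_limUnder ⟨x, hx⟩
  refine ⟨fun F ↦ Filter.limUnder U (μ · F), ⟨fun F hF ↦ ?_, ?_, fun E hE F hF hd ↦ ?_⟩, hlim⟩
  · exact ge_of_tendsto' (hlim F hF) fun d ↦ (hμ d).nonneg F hF
  · exact tendsto_nhds_unique (hlim _ univ_mem_algebra) (by simp [(hμ _).univ_eq])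
  · exact tendsto_nhds_unique (hlim _ (union_mem_algebra hE hF))
      (by simpa only [(hμ _).add E hE F hF hd] using (hlim E hE).add (hlim F hF))

variable {Ω ι : Type*} {A AL : BooleanSubalgebra (Set Ω)} {H : ι → Set Ω} {π : Set Ω → ℝ}
  {σ : Set Ω → Set Ω → ℝ} {F : Set Ω}

open Classical in
/-- The kernel used to extend the prior to pessimistic joint probabilities: the strategy on the
cells of the partition, and the point mass at `pt C` on every other event `C`. -/
noncomputable def cellKernel (H : ι → Set Ω) (σ : Set Ω → Set Ω → ℝ) (pt : Set Ω → Ω)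
    (C F : Set Ω) : ℝ :=
  if C ∈ Set.range H then σ F C else ultrafilterMass (pure (pt C)) F

variable {pt : Set Ω → Ω}

theorem cellKernel_cell (i : ι) : cellKernel H σ pt (H i) = fun F ↦ σ F (H i) :=
  funext fun _ ↦ if_pos ⟨i, rfl⟩

theorem cellKernel_of_notMem_range {C : Set Ω} (hC : C ∉ Set.range H) :
    cellKernel H σ pt C = ultrafilterMass (pure (pt C)) :=
  funext fun _ ↦ if_neg hC

namespace IsPriorStrategy

variable (h : IsPriorStrategy A AL H π σ)
include h

theorem isConcentratedKernel_cellKernel (hpt : ∀ C, C.Nonempty → pt C ∈ C) :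
    IsConcentratedKernel A (cellKernel H σ pt) where
  finAdd C := by
    by_cases hC : C ∈ Set.range H
    · obtain ⟨i, rfl⟩ := hC
      exact cellKernel_cell (H := H) i ▸ h.strategy.finAdd i
    · exact cellKernel_of_notMem_range hC ▸ isFinAddProb_ultrafilterMass A _
  self C hC := by
    by_cases hCH : C ∈ Set.range H
    · obtain ⟨i, rfl⟩ := hCH
      exact cellKernel_cell (H := H) i ▸ h.strategy_self i
    · exact cellKernel_of_notMem_range hCH ▸ ultrafilterMass_eq_one (hpt C hC)

theorem mixture_inter_cell (hpt : ∀ C, C.Nonempty → pt C ∈ C) {T : Finset AL} {i : ι}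
    (hi : ⟨H i, h.mem i⟩ ∈ T) (hF : F ∈ A) :
    mixture T π (cellKernel H σ pt) (F ∩ H i) =
      σ F (H i) * mixture T π (cellKernel H σ pt) (H i) := by
  have hκ := h.isConcentratedKernel_cellKernel hpt
  simp only [mixture, Finset.mul_sum]
  refine Finset.sum_congr rfl fun c _ ↦ ?_
  obtain hC | hC := (atomOf T c).eq_empty_or_nonempty
  · simp [hC, h.prior.empty]
  have hCA : atomOf T c ∈ A := h.le (atomOf_mem T c)
  rw [mul_left_comm]
  congr 1
  obtain hsub | hdisj := atomOf_subset_or_disjoint c hi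
  · have hCi : atomOf T c = H i := by
      refine hsub.antisymm ((h.subset_or_disjoint _ (atomOf_mem T c) i).resolve_right fun hd ↦ ?_)
      exact hC.ne_empty (hd.symm.eq_bot_of_le hsub)
    rw [hCi, cellKernel_cell]
    exact h.isDisintegrated_strategy i F hF i
  · have hzero {E} (hE : E ∈ A) (hEi : E ⊆ H i) : cellKernel H σ pt (atomOf T c) E = 0 :=
      (hκ.finAdd _).eq_zero_of_disjoint hE hCA (hdisj.symm.mono_left hEi) (hκ.self _ hC)
    rw [hzero (inter_mem_algebra hF (h.cell_mem i)) Set.inter_subset_right,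
      hzero (h.cell_mem i) subset_rfl, mul_zero]

theorem mul_cellKernel_le {S C : Set Ω} (hS : S ∈ A) (hC : C ∈ AL) (hpt : pt C ∈ S → C ⊆ S)
    {q : Set Ω → ℝ} (hq : IsJoint A AL H π σ q) : π C * cellKernel H σ pt C S ≤ q (S ∩ C) := by
  by_cases hCH : C ∈ Set.range H
  · obtain ⟨i, rfl⟩ := hCH
    rw [cellKernel_cell, hq.isDisintegrated S hS i, hq.eq_prior _ hC, mul_comm]
  rw [cellKernel_of_notMem_range hCH]
  by_cases hCS : pt C ∈ S
  · rw [ultrafilterMass_eq_one (U := pure _) hCS, mul_one, Set.inter_eq_right.2 (hpt hCS),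
      hq.eq_prior C hC]
  · rw [ultrafilterMass_eq_zero (U := pure _) hCS, mul_zero]
    exact hq.finAdd.nonneg _ (inter_mem_algebra hS (h.le hC))

theorem exists_isJoint_forall_le {𝒮 : Set (Set Ω)} (h𝒮 : ∀ S ∈ 𝒮, S ∈ A)
    (hpt : ∀ C : Set Ω, C.Nonempty → ∃ ω ∈ C, ∀ S ∈ 𝒮, ω ∈ S → C ⊆ S) :
    ∃ p, IsJoint A AL H π σ p ∧ ∀ S ∈ 𝒮, ∀ q, IsJoint A AL H π σ q → p S ≤ q S := by
  have : Nonempty Ω := (h.prior.nonempty_of_eq_one h.prior.univ_eq).to_type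
  choose! pt hptC hpt𝒮 using hpt
  have hκ := h.isConcentratedKernel_cellKernel hptC
  let μ : Finset AL → Set Ω → ℝ := fun T ↦ mixture T π (cellKernel H σ pt)
  have hμ (T) : IsFinAddProb A (μ T) := isFinAddProb_mixture h.prior hκ.finAdd T
  let U : Ultrafilter (Finset AL) := .of Filter.atTop
  obtain ⟨p, hp, hlim⟩ := exists_isFinAddProb_tendsto U hμ
  have hev (B : AL) : ∀ᶠ T in (U : Filter (Finset AL)), B ∈ T :=
    Ultrafilter.of_le _ ((Filter.eventually_ge_atTop {B}).mono fun T hT ↦ by simpa using hT)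
  refine ⟨p, ⟨hp, fun B hB ↦ ?_, fun F hF i ↦ ?_⟩, fun S hS q hq ↦ ?_⟩
  · exact tendsto_nhds_unique_of_eventuallyEq (hlim B (h.le hB)) tendsto_const_nhds
      ((hev ⟨B, hB⟩).mono fun T hT ↦ mixture_eq h.prior hκ h.le hT)
  · exact tendsto_nhds_unique_of_eventuallyEq
      (hlim _ (inter_mem_algebra hF (h.cell_mem i))) ((hlim _ (h.cell_mem i)).const_mul _)
      ((hev ⟨H i, h.mem i⟩).mono fun T hT ↦ h.mixture_inter_cell hptC hT hF)
  · refine le_of_tendsto' (hlim S (h𝒮 S hS)) fun T ↦ ?_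
    rw [← hq.finAdd.sum_inter_atomOf h.le T (h𝒮 S hS)]
    refine Finset.sum_le_sum fun c _ ↦ h.mul_cellKernel_le (h𝒮 S hS) (atomOf_mem T c) ?_ hq
    obtain hC | hC := (atomOf T c).eq_empty_or_nonempty
    · exact fun _ ↦ hC ▸ Set.empty_subset S
    · exact hpt𝒮 _ hC S hS

theorem exists_isJoint_le_of_disjoint {X Y : Set Ω} (hX : X ∈ A) (hY : Y ∈ A)
    (hXY : Disjoint X Y) : ∃ p, IsJoint A AL H π σ p ∧
      ∀ q, IsJoint A AL H π σ q → p X ≤ q X ∧ q Y ≤ p Y := by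
  have hXY' : X ⊆ Yᶜ := hXY.subset_compl_right
  have hpt : ∀ C : Set Ω, C.Nonempty → ∃ ω ∈ C, ∀ S ∈ ({X, Yᶜ} : Set _), ω ∈ S → C ⊆ S := by
    simp only [Set.mem_insert_iff, Set.mem_singleton_iff, forall_eq_or_imp, forall_eq]
    intro C hC
    by_cases hCX : C ⊆ X
    · exact hC.imp fun ω hω ↦ ⟨hω, fun _ ↦ hCX, fun _ ↦ hCX.trans hXY'⟩
    by_cases hCY : C ⊆ Yᶜ
    · obtain ⟨ω, hω, hωX⟩ := Set.not_subset.1 hCX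
      exact ⟨ω, hω, fun hωX' ↦ absurd hωX' hωX, fun _ ↦ hCY⟩
    · obtain ⟨ω, hω, hωY⟩ := Set.not_subset.1 hCY
      exact ⟨ω, hω, fun hωX ↦ absurd (hXY' hωX) hωY, fun hωY' ↦ absurd hωY' hωY⟩
  obtain ⟨p, hp, hmin⟩ := h.exists_isJoint_forall_le (by simp [hX, hY]) hpt
  refine ⟨p, hp, fun q hq ↦ ⟨hmin X (by simp) q hq, ?_⟩⟩
  have hYc := hmin Yᶜ (by simp) q hq
  rw [hp.finAdd.compl hY, hq.finAdd.compl hY] at hYc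
  linarith

end IsPriorStrategy

end MinimalJoint

section Layers

variable {Ω W : Type*} {A : BooleanSubalgebra (Set Ω)} {r : W → W → Prop} {μ : W → Set Ω → ℝ}
  {a b : W} {E K : Set Ω}

/-- `a` is the first index of the layered family `μ`, well-ordered by `r`, whose layer charges `K`;
conditioning on `K` then takes place inside the layer `μ a`. -/
def IsLeading (r : W → W → Prop) (μ : W → Set Ω → ℝ) (K : Set Ω) (a : W) : Prop :=
  0 < μ a K ∧ ∀ b, r b a → μ b K = 0

theorem exists_isLeading [IsWellFounded W r] (hμ : ∀ a, IsFinAddProb A (μ a)) (hK : K ∈ A)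
    (h : ∃ a, 0 < μ a K) : ∃ a, IsLeading r μ K a := by
  obtain ⟨a, ha, hmin⟩ := (IsWellFounded.wf (r := r)).has_min {a | 0 < μ a K} h
  exact ⟨a, ha, fun b hba ↦ (hμ b).nonneg K hK |>.antisymm' (not_lt.1 fun hb ↦ hmin b hb hba)⟩

theorem IsLeading.unique [Std.Trichotomous r] (ha : IsLeading r μ K a)
    (hb : IsLeading r μ K b) : a = b :=
  Std.Trichotomous.trichotomous (r := r) a b (fun hab ↦ ha.1.ne' (hb.2 a hab))
    fun hba ↦ hb.1.ne' (ha.2 b hba)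

theorem IsLeading.of_subset (hμ : ∀ a, IsFinAddProb A (μ a)) (hE : E ∈ A) (hK : K ∈ A)
    (hEK : E ⊆ K) (ha : IsLeading r μ K a) (hpos : 0 < μ a E) : IsLeading r μ E a :=
  ⟨hpos, fun b hba ↦ (hμ b).eq_zero_of_subset hE hK hEK (ha.2 b hba)⟩

theorem IsFinAddProb.div_inter {p : Set Ω → ℝ} (hp : IsFinAddProb A p) (hK : K ∈ A)
    (hpos : 0 < p K) : IsFinAddProb A fun E ↦ p (E ∩ K) / p K where
  nonneg E hE := div_nonneg (hp.nonneg _ (inter_mem_algebra hE hK)) hpos.le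
  univ_eq := by rw [Set.univ_inter, div_self hpos.ne']
  add E hE F hF hd := by
    rw [Set.union_inter_distrib_right, hp.add _ (inter_mem_algebra hE hK) _
      (inter_mem_algebra hF hK) (hd.mono Set.inter_subset_left Set.inter_subset_left), add_div]

theorem exists_isFullCondProb_of_layers (r : W → W → Prop) [IsWellOrder W r]
    (hμ : ∀ a, IsFinAddProb A (μ a)) (hcharge : ∀ K ∈ A, K.Nonempty → ∃ a, 0 < μ a K) :
    ∃ P, IsFullCondProb A P ∧
      ∀ K a, IsLeading r μ K a → ∀ F, P F K = μ a (F ∩ K) / μ a K := by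
  have hlead : ∀ K ∈ A, K.Nonempty → ∃ a, IsLeading r μ K a := fun K hK hne ↦
    exists_isLeading hμ hK (hcharge K hK hne)
  classical
  let P : Set Ω → Set Ω → ℝ := fun F K ↦
    if h : ∃ a, IsLeading r μ K a then μ h.choose (F ∩ K) / μ h.choose K else 0
  have hP : ∀ K a, IsLeading r μ K a → ∀ F, P F K = μ a (F ∩ K) / μ a K := fun K a ha F ↦ by
    have h : ∃ a, IsLeading r μ K a := ⟨a, ha⟩
    simp only [P, dif_pos h, h.choose_spec.unique ha]
  refine ⟨P, ⟨fun E _ K _ _ ↦ ?_, fun K hK hne ↦ ?_, fun E hE F hF K hK hne _ ↦ ?_⟩, hP⟩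
  · simp only [P, Set.inter_assoc, Set.inter_self]
  · obtain ⟨a, ha⟩ := hlead K hK hne
    simpa only [hP K a ha] using (hμ a).div_inter hK ha.1
  · obtain ⟨a, ha⟩ := hlead K hK hne
    have hEK := inter_mem_algebra hE hK
    have hEFK : E ∩ F ∩ K = F ∩ (E ∩ K) := by rw [Set.inter_comm E, Set.inter_assoc]
    rw [hP K a ha, hP K a ha, hEFK]
    obtain hzero | hpos := ((hμ a).nonneg _ hEK).eq_or_lt
    · rw [(hμ a).eq_zero_of_subset (inter_mem_algebra hF hEK) hEK Set.inter_subset_right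
        hzero.symm, ← hzero, zero_div, zero_mul]
    · rw [hP _ a (ha.of_subset hμ hEK hK Set.inter_subset_right hpos)]
      field_simp

end Layers

namespace IsFullCondProb

variable {Ω : Type*} {A : BooleanSubalgebra (Set Ω)} {P : Set Ω → Set Ω → ℝ}
  {C F K : Set Ω}

theorem self (hP : IsFullCondProb A P) (hK : K ∈ A) (hne : K.Nonempty) : P K K = 1 := by
  have h := hP.inter_cond _ univ_mem_algebra K hK hne
  rwa [Set.univ_inter, (hP.finAdd K hK hne).univ_eq, eq_comm] at h

theorem cond_inter_eq_div (hP : IsFullCondProb A P) (hF : F ∈ A) (hK : K ∈ A) (hC : C ∈ A)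
    (hne : (K ∩ C).Nonempty) (hpos : 0 < P K C) : P F (K ∩ C) = P (F ∩ K) C / P K C := by
  have h := hP.chain K hK F hF C hC (hne.mono Set.inter_subset_right) hne
  rw [Set.inter_comm F, h, mul_div_cancel_left₀ _ hpos.ne']

theorem le_of_forall_inter_le (hP : IsFullCondProb A P) (hF : F ∈ A) (hK : K ∈ A)
    (hne : K.Nonempty) {ι : Type*} {s : Finset ι} {C : ι → Set Ω} (hC : ∀ i ∈ s, C i ∈ A)
    (hCK : ∀ i ∈ s, (C i ∩ K).Nonempty) (hd : (s : Set ι).PairwiseDisjoint C)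
    (hcover : F ∩ K ⊆ ⋃ i ∈ s, C i) {c : ℝ} (hc : 0 ≤ c) (hle : ∀ i ∈ s, P F (C i ∩ K) ≤ c) :
    P F K ≤ c := by
  have hp := hP.finAdd K hK hne
  have hsum : P F K = ∑ i ∈ s, P (C i ∩ F) K := by
    have hunion : (⋃ i ∈ s, C i ∩ F) ∩ K = F ∩ K := by
      rw [← Set.iUnion₂_inter, Set.inter_assoc, Set.inter_eq_right.2 hcover]
    have hCF : ∀ i ∈ s, C i ∩ F ∈ A := fun i hi ↦ inter_mem_algebra (hC i hi) hF
    rw [← hp.biUnion hCF fun i hi j hj hij ↦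
      (hd hi hj hij).mono Set.inter_subset_left Set.inter_subset_left,
      hP.inter_cond _ (biUnion_mem_algebra hCF) K hK hne, hunion, ← hP.inter_cond F hF K hK hne]
  calc P F K = ∑ i ∈ s, P (C i) K * P F (C i ∩ K) := by
        rw [hsum]
        exact Finset.sum_congr rfl fun i hi ↦ hP.chain _ (hC i hi) F hF K hK hne (hCK i hi)
    _ ≤ ∑ i ∈ s, P (C i) K * c := by
        gcongr with i hi
        exacts [hp.nonneg _ (hC i hi), hle i hi]
    _ = P (⋃ i ∈ s, C i) K * c := by rw [← Finset.sum_mul, hp.biUnion hC hd]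
    _ ≤ c := mul_le_of_le_one_left hc (hp.le_one (biUnion_mem_algebra hC))

end IsFullCondProb

section Extension

theorem isLeading_inl {Ω V W : Type*} {r : V → V → Prop} {s : W → W → Prop}
    {μ : V → Set Ω → ℝ} {ν : W → Set Ω → ℝ} {K : Set Ω} {a : V} :
    IsLeading (Sum.Lex r s) (Sum.elim μ ν) K (.inl a) ↔ IsLeading r μ K a := by
  simp [IsLeading]

theorem isLeading_inr {Ω V W : Type*} {r : V → V → Prop} {s : W → W → Prop}
    {μ : V → Set Ω → ℝ} {ν : W → Set Ω → ℝ} {K : Set Ω} {a : W} :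
    IsLeading (Sum.Lex r s) (Sum.elim μ ν) K (.inr a) ↔
      (∀ b, μ b K = 0) ∧ IsLeading s ν K a := by
  simp only [IsLeading, Sum.elim_inr, Sum.forall, Sum.Lex.sep, Sum.elim_inl, forall_const,
    Sum.lex_inr_inr]
  tauto

theorem isLeading_cons_zero {Ω : Type*} {n : ℕ} {p : Set Ω → ℝ} {ν : Fin n → Set Ω → ℝ}
    {K : Set Ω} : IsLeading (· < ·) (Fin.cons p ν : Fin (n + 1) → Set Ω → ℝ) K 0 ↔ 0 < p K := by
  simp [IsLeading]

theorem isLeading_cons_succ {Ω : Type*} {n : ℕ} {p : Set Ω → ℝ} {ν : Fin n → Set Ω → ℝ}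
    {K : Set Ω} {l : Fin n} :
    IsLeading (· < ·) (Fin.cons p ν : Fin (n + 1) → Set Ω → ℝ) K l.succ ↔
      p K = 0 ∧ IsLeading (· < ·) ν K l := by
  simp only [IsLeading, Fin.cons_succ, Fin.forall_fin_succ, Fin.succ_pos, Fin.cons_zero,
    forall_const, Fin.succ_lt_succ_iff]
  tauto

namespace IsPriorStrategy

variable {Ω ι : Type*} {A AL : BooleanSubalgebra (Set Ω)} {H : ι → Set Ω} {π p m : Set Ω → ℝ}
  {σ : Set Ω → Set Ω → ℝ} {F K : Set Ω} (h : IsPriorStrategy A AL H π σ)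
include h

theorem exists_isFullCondProb {W : Type*} (r : W → W → Prop) [IsWellOrder W r]
    {ν : W → Set Ω → ℝ} (hν : ∀ a, IsFinAddProb A (ν a))
    (hlead : ∀ i a, IsLeading r ν (H i) a → ∀ F ∈ A, ν a (F ∩ H i) = σ F (H i) * ν a (H i)) :
    ∃ P, IsFullCondProb A P ∧ (∀ F ∈ A, ∀ i, P F (H i) = σ F (H i)) ∧
      ∀ K a, IsLeading r ν K a → ∀ F, P F K = ν a (F ∩ K) / ν a K := by
  let cells : ι → Set Ω → ℝ := fun i F ↦ σ F (H i)
  let points : Ω → Set Ω → ℝ := fun ω ↦ ultrafilterMass (pure ω)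
  let μ := Sum.elim ν (Sum.elim cells points)
  let s := Sum.Lex r (Sum.Lex (WellOrderingRel (α := ι)) (WellOrderingRel (α := Ω)))
  have hμ : ∀ a, IsFinAddProb A (μ a) := by
    rintro (a | i | ω)
    exacts [hν a, h.strategy.finAdd i, isFinAddProb_ultrafilterMass A _]
  have hcharge : ∀ K ∈ A, K.Nonempty → ∃ a, 0 < μ a K := fun K _ ⟨ω, hω⟩ ↦
    ⟨.inr (.inr ω), one_pos.trans_eq (ultrafilterMass_eq_one (U := pure ω) hω).symm⟩
  obtain ⟨P, hP, hPμ⟩ := exists_isFullCondProb_of_layers s hμ hcharge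
  refine ⟨P, hP, fun F hF i ↦ ?_, fun K a ha ↦ hPμ K (.inl a) (isLeading_inl.2 ha)⟩
  obtain ⟨a, ha⟩ := exists_isLeading (r := s) hμ (h.cell_mem i)
    (hcharge _ (h.cell_mem i) (h.isPartition.1 i))
  rw [hPμ _ a ha, div_eq_iff ha.1.ne']
  obtain a | j | ω := a
  · exact hlead i a (isLeading_inl.1 ha) F hF
  · exact h.isDisintegrated_strategy j F hF i
  · have hcell : σ (H i) (H i) = 0 := (isLeading_inr.1 (isLeading_inr.1 ha).2).1 i
    exact absurd (h.strategy_self i) (hcell ▸ zero_ne_one)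

theorem exists_mem_fullExtensions (hp : IsJoint A AL H π σ p) {n : ℕ} {ν : Fin n → Set Ω → ℝ}
    (hν : ∀ l, IsFinAddProb A (ν l))
    (hlead : ∀ i l, IsLeading (· < ·) ν (H i) l →
      ∀ F ∈ A, ν l (F ∩ H i) = σ F (H i) * ν l (H i)) :
    ∃ P ∈ fullExtensions A AL H π σ, (∀ F, P F Set.univ = p F) ∧
      ∀ K l, p K = 0 → IsLeading (· < ·) ν K l → ∀ F, P F K = ν l (F ∩ K) / ν l K := by
  have hcons : ∀ l, IsFinAddProb A (Fin.cons (α := fun _ ↦ Set Ω → ℝ) p ν l) :=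
    Fin.cases hp.finAdd hν
  obtain ⟨P, hP, hPσ, hPν⟩ := h.exists_isFullCondProb (W := Fin (n + 1)) (· < ·) hcons fun i ↦ by
    refine Fin.cases (fun _ F hF ↦ hp.isDisintegrated F hF i) fun l hl ↦ ?_
    exact hlead i l (isLeading_cons_succ.1 hl).2
  have hPp : ∀ F, P F Set.univ = p F := fun F ↦ by
    have huniv : 0 < p Set.univ := by rw [hp.finAdd.univ_eq]; exact one_pos
    simpa [hp.finAdd.univ_eq] using hPν _ 0 (isLeading_cons_zero.2 huniv) F
  exact ⟨P, ⟨hP, fun B hB ↦ (hPp B).trans (hp.eq_prior B hB), hPσ⟩, hPp,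
    fun K l hpK hl ↦ hPν K l.succ (isLeading_cons_succ.2 ⟨hpK, hl⟩)⟩

theorem isJoint_of_mem_fullExtensions {P : Set Ω → Set Ω → ℝ}
    (hP : P ∈ fullExtensions A AL H π σ) : IsJoint A AL H π σ fun F ↦ P F Set.univ := by
  obtain ⟨hPA, hPπ, hPσ⟩ := hP
  have huniv := h.prior.nonempty_of_eq_one h.prior.univ_eq
  refine ⟨hPA.finAdd _ univ_mem_algebra huniv, hPπ, fun F hF i ↦ ?_⟩
  have hchain := hPA.chain _ (h.cell_mem i) F hF _ univ_mem_algebra huniv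
    (by simpa using h.isPartition.1 i)
  rwa [Set.inter_univ, hPσ F hF, mul_comm, Set.inter_comm] at hchain

theorem exists_mem_fullExtensions_univ_eq (hp : IsJoint A AL H π σ p) :
    ∃ P ∈ fullExtensions A AL H π σ, ∀ F, P F Set.univ = p F := by
  obtain ⟨P, hP, hPp, -⟩ := h.exists_mem_fullExtensions hp (ν := Fin.elim0) (fun l ↦ l.elim0)
    fun _ l ↦ l.elim0
  exact ⟨P, hP, hPp⟩

theorem exists_mem_fullExtensions_eq_div (hp : IsJoint A AL H π σ p) (hpK : p K = 0)
    (hm : IsFinAddProb A m) (hmσ : IsDisintegrated A H σ m) (hmK : 0 < m K) :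
    ∃ P ∈ fullExtensions A AL H π σ, ∀ F, P F K = m (F ∩ K) / m K := by
  obtain ⟨P, hP, -, hPm⟩ := h.exists_mem_fullExtensions hp (ν := fun _ : Fin 1 ↦ m) (fun _ ↦ hm)
    fun i _ _ F hF ↦ hmσ F hF i
  exact ⟨P, hP, hPm K 0 hpK ⟨hmK, by simp⟩⟩

theorem exists_mem_fullExtensions_eq_zero (hp : IsJoint A AL H π σ p) (hK : K ∈ A)
    (hpK : p K = 0) {i : ι} (hi : (H i ∩ Fᶜ ∩ K).Nonempty) (hσ : σ (F ∩ K) (H i) = 0) :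
    ∃ P ∈ fullExtensions A AL H π σ, P F K = 0 := by
  obtain ⟨ω, ⟨hωi, hωF⟩, hωK⟩ := hi
  let ν : Fin 2 → Set Ω → ℝ := ![fun F ↦ σ F (H i), ultrafilterMass (pure ω)]
  have hν : ∀ l, IsFinAddProb A (ν l) :=
    Fin.forall_fin_two.2 ⟨h.strategy.finAdd i, isFinAddProb_ultrafilterMass A _⟩
  have hlead : ∀ j l, IsLeading (· < ·) ν (H j) l →
      ∀ G ∈ A, ν l (G ∩ H j) = σ G (H j) * ν l (H j) := by
    intro j
    refine Fin.forall_fin_two.2 ⟨fun _ G hG ↦ h.isDisintegrated_strategy i G hG j, fun hl ↦ ?_⟩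
    have hωj : ω ∉ H j := fun hωj ↦ by
      have hzero : σ (H j) (H i) = 0 := hl.2 0 Fin.zero_lt_one
      rw [h.eq_of_mem hωi hωj, h.strategy_self j] at hzero
      exact one_ne_zero hzero
    exact absurd (ultrafilterMass_eq_zero (U := pure ω) hωj) hl.1.ne'
  obtain ⟨P, hP, -, hPν⟩ := h.exists_mem_fullExtensions hp hν hlead
  obtain ⟨l, hl⟩ := exists_isLeading (r := fun a b : Fin 2 ↦ a < b) hν hK
    ⟨1, one_pos.trans_eq (ultrafilterMass_eq_one (U := pure ω) hωK).symm⟩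
  have hνF : ∀ l, ν l (F ∩ K) = 0 :=
    Fin.forall_fin_two.2 ⟨hσ, ultrafilterMass_eq_zero (U := pure ω) fun hω ↦ hωF hω.1⟩
  exact ⟨P, hP, by rw [hPν K l hpK hl, hνF, zero_div]⟩

end IsPriorStrategy

end Extension

theorem subset_or_disjoint_of_mem_completeAlgebra {Ω ι : Type*} {H : ι → Set Ω}
    (hH : Pairwise fun i j ↦ Disjoint (H i) (H j)) {B : Set Ω}
    (hB : B ∈ completeAlgebra (Set.range H)) (i : ι) : H i ⊆ B ∨ Disjoint (H i) B := by
  let saturated : BooleanSubalgebra (Set Ω) :=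
    { carrier := {X | ∀ ω ∈ H i, ∀ ω' ∈ H i, ω ∈ X → ω' ∈ X}
      supClosed' := fun X hX Y hY ω hω ω' hω' ↦ Or.imp (hX ω hω ω' hω') (hY ω hω ω' hω')
      infClosed' := fun X hX Y hY ω hω ω' hω' ↦ And.imp (hX ω hω ω' hω') (hY ω hω ω' hω')
      compl_mem' := fun hX ω hω ω' hω' ↦ mt (hX ω' hω' ω hω)
      bot_mem' := fun _ _ _ _ ↦ id }
  have hcell : Set.range H ⊆ saturated := by
    rintro _ ⟨j, rfl⟩ ω hω ω' hω' hωj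
    rwa [hH.eq (Set.not_disjoint_iff.2 ⟨ω, hωj, hω⟩)]
  have hB' : ∀ ω ∈ H i, ∀ ω' ∈ H i, ω ∈ B → ω' ∈ B := hB saturated hcell
    fun T hT ω hω ω' hω' ⟨X, hX, hωX⟩ ↦ ⟨X, hX, hT hX ω hω ω' hω' hωX⟩
  by_cases hd : Disjoint (H i) B
  · exact .inr hd
  · obtain ⟨ω, hω, hωB⟩ := Set.not_disjoint_iff.1 hd
    exact .inl fun ω' hω' ↦ hB' ω hω ω' hω' hωB

theorem IsPartition.isAtomicPartition {Ω ι : Type*} {AL : BooleanSubalgebra (Set Ω)}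
    {H : ι → Set Ω} (hH : IsPartition H) (hAL : BooleanSubalgebra.closure (Set.range H) ≤ AL)
    (hAL' : (AL : Set (Set Ω)) ⊆ completeAlgebra (Set.range H)) : IsAtomicPartition AL H where
  isPartition := hH
  mem i := hAL (BooleanSubalgebra.subset_closure ⟨i, rfl⟩)
  subset_or_disjoint _ hB := subset_or_disjoint_of_mem_completeAlgebra hH.2.1 (hAL' hB)

section JointEnvelope

namespace IsPriorStrategy

variable {Ω ι : Type*} {A AL : BooleanSubalgebra (Set Ω)} {H : ι → Set Ω} {π : Set Ω → ℝ}
  {σ : Set Ω → Set Ω → ℝ} {F K X Y : Set Ω} (h : IsPriorStrategy A AL H π σ)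
include h

theorem exists_isJoint_isLeast_isGreatest (hX : X ∈ A) (hY : Y ∈ A) (hXY : Disjoint X Y) :
    ∃ p, IsJoint A AL H π σ p ∧ IsLeast (jointValues A AL H π σ X) (p X) ∧
      IsGreatest (jointValues A AL H π σ Y) (p Y) := by
  obtain ⟨p, hp, hopt⟩ := h.exists_isJoint_le_of_disjoint hX hY hXY
  have hmem := h.mem_jointProbs_iff.2 hp
  exact ⟨p, hp, ⟨⟨p, hmem, rfl⟩, Set.forall_mem_image.2 fun q hq ↦
    (hopt q (h.isJoint_of_mem_jointProbs hq)).1⟩, ⟨p, hmem, rfl⟩, Set.forall_mem_image.2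
    fun q hq ↦ (hopt q (h.isJoint_of_mem_jointProbs hq)).2⟩

theorem exists_isJoint_eq_lowerJoint_upperJoint (hX : X ∈ A) (hY : Y ∈ A)
    (hXY : Disjoint X Y) : ∃ p, IsJoint A AL H π σ p ∧
      p X = lowerJoint A AL H π σ X ∧ p Y = upperJoint A AL H π σ Y := by
  obtain ⟨p, hp, hleast, hgreatest⟩ := h.exists_isJoint_isLeast_isGreatest hX hY hXY
  exact ⟨p, hp, hleast.csInf_eq.symm, hgreatest.csSup_eq.symm⟩

theorem isLeast_lowerJoint (hF : F ∈ A) :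
    IsLeast (jointValues A AL H π σ F) (lowerJoint A AL H π σ F) := by
  obtain ⟨p, -, hleast, -⟩ :=
    h.exists_isJoint_isLeast_isGreatest hF A.bot_mem disjoint_bot_right
  rwa [lowerJoint, hleast.csInf_eq]

theorem isGreatest_upperJoint (hF : F ∈ A) :
    IsGreatest (jointValues A AL H π σ F) (upperJoint A AL H π σ F) := by
  obtain ⟨p, -, -, hgreatest⟩ :=
    h.exists_isJoint_isLeast_isGreatest A.bot_mem hF disjoint_bot_left
  rwa [upperJoint, hgreatest.csSup_eq]

theorem lowerJoint_le (hF : F ∈ A) {q : Set Ω → ℝ} (hq : IsJoint A AL H π σ q) :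
    lowerJoint A AL H π σ F ≤ q F :=
  (h.isLeast_lowerJoint hF).2 ⟨q, h.mem_jointProbs_iff.2 hq, rfl⟩

theorem le_upperJoint (hF : F ∈ A) {q : Set Ω → ℝ} (hq : IsJoint A AL H π σ q) :
    q F ≤ upperJoint A AL H π σ F :=
  (h.isGreatest_upperJoint hF).2 ⟨q, h.mem_jointProbs_iff.2 hq, rfl⟩

theorem isLeast_lowerAuxValues (hF : F ∈ A) (hK : K ∈ A) :
    IsLeast (lowerAuxValues A AL H π σ F K) (lowerJoint A AL H π σ (F ∩ K)) := by
  have hFK := inter_mem_algebra hF hK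
  obtain ⟨p, hp, hlow, hup⟩ := h.exists_isJoint_eq_lowerJoint_upperJoint hFK
    (inter_mem_algebra (A.compl_mem hF) hK) (disjoint_compl_right.inter_left _ |>.inter_right _)
  exact ⟨⟨p, ⟨h.mem_jointProbs_iff.2 hp, hup⟩, hlow⟩, Set.forall_mem_image.2 fun q hq ↦
    h.lowerJoint_le hFK (h.isJoint_of_mem_jointProbs hq.1)⟩

theorem isGreatest_upperAuxValues (hF : F ∈ A) (hK : K ∈ A) :
    IsGreatest (upperAuxValues A AL H π σ F K) (upperJoint A AL H π σ (F ∩ K)) := by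
  have hFK := inter_mem_algebra hF hK
  obtain ⟨p, hp, hlow, hup⟩ := h.exists_isJoint_eq_lowerJoint_upperJoint
    (inter_mem_algebra (A.compl_mem hF) hK) hFK (disjoint_compl_left.inter_left _ |>.inter_right _)
  exact ⟨⟨p, ⟨h.mem_jointProbs_iff.2 hp, hlow⟩, hup⟩, Set.forall_mem_image.2 fun q hq ↦
    h.le_upperJoint hFK (h.isJoint_of_mem_jointProbs hq.1)⟩

theorem lowerAux_eq (hF : F ∈ A) (hK : K ∈ A) :
    lowerAux A AL H π σ F K = lowerJoint A AL H π σ (F ∩ K) :=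
  (h.isLeast_lowerAuxValues hF hK).csInf_eq

theorem upperAux_eq (hF : F ∈ A) (hK : K ∈ A) :
    upperAux A AL H π σ F K = upperJoint A AL H π σ (F ∩ K) :=
  (h.isGreatest_upperAuxValues hF hK).csSup_eq

theorem isLeast_lowerAux (hF : F ∈ A) (hK : K ∈ A) :
    IsLeast (lowerAuxValues A AL H π σ F K) (lowerAux A AL H π σ F K) := by
  rw [h.lowerAux_eq hF hK]
  exact h.isLeast_lowerAuxValues hF hK

theorem isGreatest_upperAux (hF : F ∈ A) (hK : K ∈ A) :
    IsGreatest (upperAuxValues A AL H π σ F K) (upperAux A AL H π σ F K) := by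
  rw [h.upperAux_eq hF hK]
  exact h.isGreatest_upperAuxValues hF hK

theorem exists_isJoint_eq_zero (hK : K ∈ A) (h0 : lowerJoint A AL H π σ K = 0) :
    ∃ p, IsJoint A AL H π σ p ∧ p K = 0 := by
  obtain ⟨p, hp, hpK⟩ := (h.isLeast_lowerJoint hK).1
  exact ⟨p, h.isJoint_of_mem_jointProbs hp, hpK.trans h0⟩

end IsPriorStrategy

end JointEnvelope

section LowerEnvelope

theorem div_add_le_div_add {a b c d : ℝ} (ha : 0 ≤ a) (hd : 0 ≤ d) (hac : a ≤ c) (hdb : d ≤ b)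
    (hab : 0 < a + b) (hcd : 0 < c + d) : a / (a + b) ≤ c / (c + d) := by
  rw [div_le_div_iff₀ hab hcd]
  linarith [mul_le_mul hac hdb hd (ha.trans hac)]

theorem exists_ultrafilter_forall_notMem {Ω ι : Type*} {H : ι → Set Ω}
    (hH : Pairwise fun i j ↦ Disjoint (H i) (H j)) {S : Set Ω}
    (hS : {i | (H i ∩ S).Nonempty}.Infinite) : ∃ U : Ultrafilter Ω, S ∈ U ∧ ∀ i, H i ∉ U := by
  have : Infinite {i | (H i ∩ S).Nonempty} := hS.to_subtype
  choose x hxH hxS using fun i : {i | (H i ∩ S).Nonempty} ↦ i.2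
  refine ⟨(Filter.hyperfilter _).map x, Ultrafilter.mem_map.2 (Filter.univ_mem' hxS), fun i ↦ ?_⟩
  refine Filter.notMem_hyperfilter_of_finite (Set.Subsingleton.finite fun j hj k hk ↦ ?_)
  have hcell : ∀ l, x l ∈ H i → l.1 = i := fun l hl ↦
    hH.eq (Set.not_disjoint_iff.2 ⟨x l, hxH l, hl⟩)
  exact Subtype.ext ((hcell j hj).trans (hcell k hk).symm)

namespace IsPriorStrategy

variable {Ω ι : Type*} {A AL : BooleanSubalgebra (Set Ω)} {H : ι → Set Ω} {π : Set Ω → ℝ}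
  {σ : Set Ω → Set Ω → ℝ} {F K : Set Ω} (h : IsPriorStrategy A AL H π σ)
include h

theorem isLeast_extensionValues_one (hF : F ∈ A) (hK : K ∈ A) (hne : K.Nonempty)
    (hFK : F ∩ K = K) : IsLeast (extensionValues A AL H π σ F K) 1 := by
  have hone : ∀ P ∈ fullExtensions A AL H π σ, P F K = 1 := fun P hP ↦ by
    rw [hP.1.inter_cond F hF K hK hne, hFK, hP.1.self hK hne]
  obtain ⟨p, hp, -⟩ := h.exists_isJoint_isLeast_isGreatest hF A.bot_mem disjoint_bot_right
  obtain ⟨P, hP, -⟩ := h.exists_mem_fullExtensions_univ_eq hp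
  exact ⟨⟨P, hP, hone P hP⟩, Set.forall_mem_image.2 fun P hP ↦ (hone P hP).ge⟩

theorem isLeast_extensionValues_div (hF : F ∈ A) (hK : K ∈ A)
    (hpos : 0 < lowerJoint A AL H π σ K) :
    IsLeast (extensionValues A AL H π σ F K) (lowerJoint A AL H π σ (F ∩ K) /
      (lowerJoint A AL H π σ (F ∩ K) + upperJoint A AL H π σ (Fᶜ ∩ K))) := by
  have hFK := inter_mem_algebra hF hK
  have hFcK := inter_mem_algebra (A.compl_mem hF) hK
  have hvalue : ∀ P ∈ fullExtensions A AL H π σ, P F K =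
      P (F ∩ K) Set.univ / (P (F ∩ K) Set.univ + P (Fᶜ ∩ K) Set.univ) := fun P hP ↦ by
    have hp := h.isJoint_of_mem_fullExtensions hP
    have hPK := hpos.trans_le (h.lowerJoint_le hK hp)
    have hne : (K ∩ Set.univ).Nonempty := by
      rw [Set.inter_univ, Set.nonempty_iff_ne_empty]
      rintro rfl
      exact hPK.ne' hp.finAdd.empty
    rw [hp.finAdd.inter_add_compl_inter hF hK,
      ← hP.1.cond_inter_eq_div hF hK univ_mem_algebra hne hPK, Set.inter_univ]
  obtain ⟨p, hp, hlow, hup⟩ := h.exists_isJoint_eq_lowerJoint_upperJoint hFK hFcK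
    (disjoint_compl_right.inter_left _ |>.inter_right _)
  obtain ⟨P, hP, hPp⟩ := h.exists_mem_fullExtensions_univ_eq hp
  refine ⟨⟨P, hP, ?_⟩, Set.forall_mem_image.2 fun Q hQ ↦ ?_⟩
  · rw [← hlow, ← hup, ← hPp, ← hPp]
    exact hvalue P hP
  · have hq := h.isJoint_of_mem_fullExtensions hQ
    have hpos' : ∀ q, IsJoint A AL H π σ q → 0 < q (F ∩ K) + q (Fᶜ ∩ K) := fun q hq ↦ by
      rw [hq.finAdd.inter_add_compl_inter hF hK]
      exact hpos.trans_le (h.lowerJoint_le hK hq)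
    rw [hvalue Q hQ, ← hlow, ← hup]
    exact div_add_le_div_add (hp.finAdd.nonneg _ hFK) (hq.finAdd.nonneg _ hFcK)
      (hlow.trans_le (h.lowerJoint_le hFK hq)) ((h.le_upperJoint hFcK hq).trans_eq hup.symm)
      (hpos' p hp) (hpos' _ hq)

theorem cond_cell_inter_eq_div {P : Set Ω → Set Ω → ℝ} (hP : P ∈ fullExtensions A AL H π σ)
    (hF : F ∈ A) (hK : K ∈ A) {i : ι} (hne : (H i ∩ K).Nonempty) (hpos : 0 < σ K (H i)) :
    P F (H i ∩ K) = σ (F ∩ K) (H i) / σ K (H i) := by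
  rw [Set.inter_comm] at hne ⊢
  rw [hP.1.cond_inter_eq_div hF hK (h.cell_mem i) hne (hP.2.2 K hK i ▸ hpos), hP.2.2 K hK i,
    hP.2.2 _ (inter_mem_algebra hF hK) i]

theorem le_of_mem_fullExtensions {P : Set Ω → Set Ω → ℝ} (hP : P ∈ fullExtensions A AL H π σ)
    (hF : F ∈ A) (hK : K ∈ A) (hne : (indexTwo H F K).Nonempty) (h3 : indexThree H F K = ∅)
    (hfin : (indexTwo H F K).Finite) (hpos : ∀ i ∈ indexTwo H F K, 0 < σ K (H i)) {r : ℝ}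
    (hr : ∀ i ∈ indexTwo H F K, r ≤ σ (F ∩ K) (H i) / σ K (H i)) : r ≤ P F K := by
  have hcellne : ∀ i ∈ indexTwo H F K, (H i ∩ K).Nonempty := fun i hi ↦
    (Set.nonempty_iff_ne_empty.2 hi.1).mono
      (Set.inter_subset_inter_left _ Set.inter_subset_left)
  have hcell : ∀ i ∈ indexTwo H F K, P Fᶜ (H i ∩ K) ≤ 1 - r := fun i hi ↦ by
    have hPi := hP.1.finAdd _ (inter_mem_algebra (h.cell_mem i) hK) (hcellne i hi)
    rw [hPi.compl hF, h.cond_cell_inter_eq_div hP hF hK (hcellne i hi) (hpos i hi)]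
    exact sub_le_sub_left (hr i hi) 1
  obtain ⟨i, hi⟩ := hne
  have hKne : K.Nonempty := (hcellne i hi).mono Set.inter_subset_right
  have hr1 : 0 ≤ 1 - r := ((hP.1.finAdd _ (inter_mem_algebra (h.cell_mem i) hK)
    (hcellne i hi)).nonneg _ (A.compl_mem hF)).trans (hcell i hi)
  have hcover : Fᶜ ∩ K ⊆ ⋃ i ∈ hfin.toFinset, H i := fun ω hω ↦ by
    obtain ⟨j, hj⟩ := h.exists_mem ω
    have hjc : H j ∩ Fᶜ ∩ K ≠ ∅ := Set.nonempty_iff_ne_empty.1 ⟨ω, ⟨hj, hω.1⟩, hω.2⟩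
    have hj3 : j ∉ indexThree H F K := h3 ▸ Set.notMem_empty j
    exact Set.mem_biUnion (hfin.mem_toFinset.2 ⟨fun hjF ↦ hj3 ⟨hjF, hjc⟩, hjc⟩) hj
  have hPc : P Fᶜ K ≤ 1 - r := hP.1.le_of_forall_inter_le (A.compl_mem hF) hK hKne
    (fun i _ ↦ h.cell_mem i) (fun i hi ↦ hcellne i (hfin.mem_toFinset.1 hi))
    (fun i _ j _ hij ↦ h.isPartition.2.1 hij) hcover hr1
    (fun i hi ↦ hcell i (hfin.mem_toFinset.1 hi))
  rw [(hP.1.finAdd K hK hKne).compl hF] at hPc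
  linarith

theorem exists_isLeast_image_isLeast_extensionValues (hF : F ∈ A) (hK : K ∈ A)
    (h0 : lowerJoint A AL H π σ K = 0) (hne : (indexTwo H F K).Nonempty)
    (h3 : indexThree H F K = ∅) (hfin : (indexTwo H F K).Finite)
    (hpos : ∀ i ∈ indexTwo H F K, 0 < σ K (H i)) :
    ∃ r, IsLeast ((fun i ↦ σ (F ∩ K) (H i) / σ K (H i)) '' indexTwo H F K) r ∧
      IsLeast (extensionValues A AL H π σ F K) r := by
  obtain ⟨i, hi, hmin⟩ :=
    Set.exists_min_image _ (fun i ↦ σ (F ∩ K) (H i) / σ K (H i)) hfin hne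
  obtain ⟨p, hp, hpK⟩ := h.exists_isJoint_eq_zero hK h0
  obtain ⟨P, hP, hPi⟩ := h.exists_mem_fullExtensions_eq_div hp hpK (h.strategy.finAdd i)
    (h.isDisintegrated_strategy i) (hpos i hi)
  exact ⟨_, ⟨⟨i, hi, rfl⟩, Set.forall_mem_image.2 hmin⟩, ⟨P, hP, hPi F⟩,
    Set.forall_mem_image.2 fun Q hQ ↦ h.le_of_mem_fullExtensions hQ hF hK hne h3 hfin hpos hmin⟩

theorem exists_mem_fullExtensions_eq_zero_of_infinite {p : Set Ω → ℝ}
    (hp : IsJoint A AL H π σ p) (hpK : p K = 0)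
    (hinf : {i | (H i ∩ (Fᶜ ∩ K)).Nonempty}.Infinite) :
    ∃ P ∈ fullExtensions A AL H π σ, P F K = 0 := by
  obtain ⟨U, hFcK, hH⟩ := exists_ultrafilter_forall_notMem h.isPartition.2.1 hinf
  have hU := isFinAddProb_ultrafilterMass A U
  have hUK : ultrafilterMass U K = 1 :=
    ultrafilterMass_eq_one (Filter.mem_of_superset hFcK Set.inter_subset_right)
  have hUF : ultrafilterMass U (F ∩ K) = 0 := ultrafilterMass_eq_zero fun hFK ↦
    Ultrafilter.compl_notMem_iff.2 (Filter.mem_of_superset hFK Set.inter_subset_left)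
      (Filter.mem_of_superset hFcK Set.inter_subset_left)
  obtain ⟨P, hP, hPU⟩ := h.exists_mem_fullExtensions_eq_div hp hpK hU
    (hU.isDisintegrated_of_eq_zero h.cell_mem fun i ↦ ultrafilterMass_eq_zero (hH i))
    (hUK.symm ▸ one_pos)
  exact ⟨P, hP, by rw [hPU, hUF, zero_div]⟩

theorem indexTwo_conditions_of_forall_ne_zero (hF : F ∈ A) (hK : K ∈ A) (hFK : F ∩ K ≠ K)
    (hσ : ∀ i, (H i ∩ Fᶜ ∩ K).Nonempty → σ (F ∩ K) (H i) ≠ 0)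
    (hfin : {i | (H i ∩ (Fᶜ ∩ K)).Nonempty}.Finite) :
    (indexTwo H F K).Nonempty ∧ indexThree H F K = ∅ ∧ (indexTwo H F K).Finite ∧
      ∀ i ∈ indexTwo H F K, 0 < σ K (H i) := by
  have hFKA := inter_mem_algebra hF hK
  have hmeets : ∀ i, H i ∩ Fᶜ ∩ K ≠ ∅ → H i ∩ F ∩ K ≠ ∅ := fun i hi hFi ↦
    hσ i (Set.nonempty_iff_ne_empty.2 hi) (h.strategy.eq_zero_of_disjoint (h.cell_mem i) hFKA
      (Set.disjoint_iff_inter_eq_empty.2 (by rw [Set.inter_comm, ← Set.inter_assoc, hFi])))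
  refine ⟨?_, ?_, hfin.subset fun i hi ↦ ?_, fun i hi ↦ ?_⟩
  · obtain ⟨ω, hωK, hωF⟩ := Set.not_subset.1 (mt Set.inter_eq_right.2 hFK)
    obtain ⟨i, hi⟩ := h.exists_mem ω
    have hic : H i ∩ Fᶜ ∩ K ≠ ∅ := Set.nonempty_iff_ne_empty.1 ⟨ω, ⟨hi, hωF⟩, hωK⟩
    exact ⟨i, hmeets i hic, hic⟩
  · exact Set.eq_empty_of_forall_notMem fun i hi ↦ hmeets i hi.2 hi.1
  · exact Set.nonempty_iff_ne_empty.2 (Set.inter_assoc (H i) Fᶜ K ▸ hi.2)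
  · have hσi := h.strategy.finAdd i
    exact ((hσi.nonneg _ hFKA).lt_of_ne' (hσ i (Set.nonempty_iff_ne_empty.2 hi.2))).trans_le
      (hσi.mono hFKA hK Set.inter_subset_right)

theorem isLeast_extensionValues_zero (hF : F ∈ A) (hK : K ∈ A) (hne : K.Nonempty)
    (hFK : F ∩ K ≠ K) (h0 : lowerJoint A AL H π σ K = 0)
    (hnot : ¬ ((indexTwo H F K).Nonempty ∧ indexThree H F K = ∅ ∧ (indexTwo H F K).Finite ∧
      ∀ i ∈ indexTwo H F K, 0 < σ K (H i))) :
    IsLeast (extensionValues A AL H π σ F K) 0 := by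
  obtain ⟨p, hp, hpK⟩ := h.exists_isJoint_eq_zero hK h0
  refine ⟨?_, Set.forall_mem_image.2 fun P hP ↦ (hP.1.finAdd K hK hne).nonneg F hF⟩
  by_cases hσ : ∃ i, (H i ∩ Fᶜ ∩ K).Nonempty ∧ σ (F ∩ K) (H i) = 0
  · obtain ⟨i, hi, hσi⟩ := hσ
    exact h.exists_mem_fullExtensions_eq_zero hp hK hpK hi hσi
  · push Not at hσ
    exact h.exists_mem_fullExtensions_eq_zero_of_infinite hp hpK fun hfin ↦
      hnot (h.indexTwo_conditions_of_forall_ne_zero hF hK hFK hσ hfin)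

theorem exists_isLeast_extensionValues (hF : F ∈ A) (hK : K ∈ A) (hne : K.Nonempty) :
    ∃ r, IsLeast (extensionValues A AL H π σ F K) r := by
  by_cases hFK : F ∩ K = K
  · exact ⟨1, h.isLeast_extensionValues_one hF hK hne hFK⟩
  obtain ⟨p, hp, hpK⟩ := (h.isLeast_lowerJoint hK).1
  have hnonneg : 0 ≤ lowerJoint A AL H π σ K :=
    hpK ▸ (h.isJoint_of_mem_jointProbs hp).finAdd.nonneg K hK
  obtain h0 | hpos := hnonneg.eq_or_lt
  · by_cases hcond : (indexTwo H F K).Nonempty ∧ indexThree H F K = ∅ ∧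
        (indexTwo H F K).Finite ∧ ∀ i ∈ indexTwo H F K, 0 < σ K (H i)
    · obtain ⟨hne₂, h₃, hfin, hσpos⟩ := hcond
      obtain ⟨r, -, hr⟩ :=
        h.exists_isLeast_image_isLeast_extensionValues hF hK h0.symm hne₂ h₃ hfin hσpos
      exact ⟨r, hr⟩
    · exact ⟨0, h.isLeast_extensionValues_zero hF hK hne hFK h0.symm hcond⟩
  · exact ⟨_, h.isLeast_extensionValues_div hF hK hpos⟩

theorem isLeast_lowerEnvelope (hF : F ∈ A) (hK : K ∈ A) (hne : K.Nonempty) :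
    IsLeast (extensionValues A AL H π σ F K) (lowerEnvelope A AL H π σ F K) := by
  obtain ⟨r, hr⟩ := h.exists_isLeast_extensionValues hF hK hne
  rwa [lowerEnvelope, hr.csInf_eq]

theorem lowerEnvelope_eq_min (hF : F ∈ A) (hK : K ∈ A)
    (hpos : 0 < lowerJoint A AL H π σ K) :
    lowerEnvelope A AL H π σ F K =
      min
        (lowerJoint A AL H π σ (F ∩ K) /
          (lowerJoint A AL H π σ (F ∩ K) + upperAux A AL H π σ Fᶜ K))
        (lowerAux A AL H π σ F K /
          (lowerAux A AL H π σ F K + upperJoint A AL H π σ (Fᶜ ∩ K))) := by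
  rw [h.lowerAux_eq hF hK, h.upperAux_eq (A.compl_mem hF) hK, min_self]
  exact (h.isLeast_extensionValues_div hF hK hpos).csInf_eq

theorem isLeast_image_lowerEnvelope (hF : F ∈ A) (hK : K ∈ A)
    (h0 : lowerJoint A AL H π σ K = 0) (hne : (indexTwo H F K).Nonempty)
    (h3 : indexThree H F K = ∅) (hfin : (indexTwo H F K).Finite)
    (hpos : ∀ i ∈ indexTwo H F K, 0 < σ K (H i)) :
    IsLeast ((fun i ↦ σ (F ∩ K) (H i) / σ K (H i)) '' indexTwo H F K)
      (lowerEnvelope A AL H π σ F K) := by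
  obtain ⟨r, hr, hleast⟩ :=
    h.exists_isLeast_image_isLeast_extensionValues hF hK h0 hne h3 hfin hpos
  rwa [lowerEnvelope, hleast.csInf_eq]

end IsPriorStrategy

end LowerEnvelope

theorem theorem2_general {Ω I : Type*}
    (H : I → Set Ω) (hH : IsPartition H) (AL A : BooleanSubalgebra (Set Ω))
    (hAL : BooleanSubalgebra.closure (Set.range H) ≤ AL)
    (hAL' : (AL : Set (Set Ω)) ⊆ completeAlgebra (Set.range H))
    (hA : AL ≤ A)
    (σ : Set Ω → Set Ω → ℝ) (hσ : IsStrategy A H σ)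
    (π : Set Ω → ℝ) (hπ : IsFinAddProb AL π) :
    (∀ F ∈ A, IsLeast (jointValues A AL H π σ F) (lowerJoint A AL H π σ F) ∧
      IsGreatest (jointValues A AL H π σ F) (upperJoint A AL H π σ F)) ∧
    (∀ F ∈ A, ∀ K ∈ A, K ≠ ∅ →
      IsLeast (lowerAuxValues A AL H π σ F K) (lowerAux A AL H π σ F K) ∧
      IsGreatest (upperAuxValues A AL H π σ F K) (upperAux A AL H π σ F K) ∧
      IsLeast (extensionValues A AL H π σ F K) (lowerEnvelope A AL H π σ F K)) ∧
    (∀ F ∈ A, ∀ K ∈ A, K ≠ ∅ →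
      (F ∩ K = K → lowerEnvelope A AL H π σ F K = 1) ∧
      (F ∩ K ≠ K →
        (0 < lowerJoint A AL H π σ K →
          lowerEnvelope A AL H π σ F K =
            min
              (lowerJoint A AL H π σ (F ∩ K) /
                (lowerJoint A AL H π σ (F ∩ K) + upperAux A AL H π σ Fᶜ K))
              (lowerAux A AL H π σ F K /
                (lowerAux A AL H π σ F K + upperJoint A AL H π σ (Fᶜ ∩ K)))) ∧
        (lowerJoint A AL H π σ K = 0 →
          (((indexTwo H F K).Nonempty ∧ indexThree H F K = ∅ ∧ (indexTwo H F K).Finite ∧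
              ∀ i ∈ indexTwo H F K, 0 < σ K (H i)) →
            IsLeast ((fun i => σ (F ∩ K) (H i) / σ K (H i)) '' indexTwo H F K)
              (lowerEnvelope A AL H π σ F K)) ∧
          (¬ ((indexTwo H F K).Nonempty ∧ indexThree H F K = ∅ ∧ (indexTwo H F K).Finite ∧
              ∀ i ∈ indexTwo H F K, 0 < σ K (H i)) →
            lowerEnvelope A AL H π σ F K = 0)))) := by
  have h : IsPriorStrategy A AL H π σ := ⟨hH.isAtomicPartition hAL hAL', hA, hπ, hσ⟩
  simp only [← Set.nonempty_iff_ne_empty]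
  refine ⟨fun F hF ↦ ⟨h.isLeast_lowerJoint hF, h.isGreatest_upperJoint hF⟩,
    fun F hF K hK hne ↦ ⟨h.isLeast_lowerAux hF hK, h.isGreatest_upperAux hF hK,
      h.isLeast_lowerEnvelope hF hK hne⟩,
    fun F hF K hK hne ↦ ⟨fun hFK ↦ ?_, fun hFK ↦ ⟨fun hpos ↦ ?_, fun h0 ↦ ⟨?_, fun hnot ↦ ?_⟩⟩⟩⟩
  · exact (h.isLeast_extensionValues_one hF hK hne hFK).csInf_eq
  · exact h.lowerEnvelope_eq_min hF hK hpos
  · rintro ⟨hne₂, h₃, hfin, hσK⟩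
    exact h.isLeast_image_lowerEnvelope hF hK h0 hne₂ h₃ hfin hσK
  · exact (h.isLeast_extensionValues_zero hF hK hne hFK h0 hnot).csInf_eq

theorem theorem2 {Ω I J : Type*}
    (H : I → Set Ω) (hH : IsPartition H) (E : J → Set Ω) (hE : IsPartition E)
    (AL AE A : BooleanSubalgebra (Set Ω))
    (hAL : BooleanSubalgebra.closure (Set.range H) ≤ AL)
    (hAL' : (AL : Set (Set Ω)) ⊆ completeAlgebra (Set.range H))
    (hAE : BooleanSubalgebra.closure (Set.range E) ≤ AE)
    (hAE' : (AE : Set (Set Ω)) ⊆ completeAlgebra (Set.range E))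
    (hA : BooleanSubalgebra.closure ((AL : Set (Set Ω)) ∪ (AE : Set (Set Ω))) ≤ A)
    (hA' : (A : Set (Set Ω)) ⊆ completeAlgebra ((AL : Set (Set Ω)) ∪ (AE : Set (Set Ω))))
    (σ : Set Ω → Set Ω → ℝ) (hσ : IsStrategy A H σ)
    (π : Set Ω → ℝ) (hπ : IsFinAddProb AL π) :
    -- the envelopes and the auxiliary functions are attained minima and maxima
    (∀ F ∈ A, IsLeast (jointValues A AL H π σ F) (lowerJoint A AL H π σ F) ∧
      IsGreatest (jointValues A AL H π σ F) (upperJoint A AL H π σ F)) ∧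
    (∀ F ∈ A, ∀ K ∈ A, K ≠ ∅ →
      IsLeast (lowerAuxValues A AL H π σ F K) (lowerAux A AL H π σ F K) ∧
      IsGreatest (upperAuxValues A AL H π σ F K) (upperAux A AL H π σ F K) ∧
      IsLeast (extensionValues A AL H π σ F K) (lowerEnvelope A AL H π σ F K)) ∧
    -- the closed form of the lower envelope
    (∀ F ∈ A, ∀ K ∈ A, K ≠ ∅ →
      (F ∩ K = K → lowerEnvelope A AL H π σ F K = 1) ∧
      (F ∩ K ≠ K →
        (0 < lowerJoint A AL H π σ K →
          lowerEnvelope A AL H π σ F K =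
            min
              (lowerJoint A AL H π σ (F ∩ K) /
                (lowerJoint A AL H π σ (F ∩ K) + upperAux A AL H π σ Fᶜ K))
              (lowerAux A AL H π σ F K /
                (lowerAux A AL H π σ F K + upperJoint A AL H π σ (Fᶜ ∩ K)))) ∧
        (lowerJoint A AL H π σ K = 0 →
          (((indexTwo H F K).Nonempty ∧ indexThree H F K = ∅ ∧ (indexTwo H F K).Finite ∧
              ∀ i ∈ indexTwo H F K, 0 < σ K (H i)) →
            IsLeast ((fun i => σ (F ∩ K) (H i) / σ K (H i)) '' indexTwo H F K)
              (lowerEnvelope A AL H π σ F K)) ∧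
          (¬ ((indexTwo H F K).Nonempty ∧ indexThree H F K = ∅ ∧ (indexTwo H F K).Finite ∧
              ∀ i ∈ indexTwo H F K, 0 < σ K (H i)) →
            lowerEnvelope A AL H π σ F K = 0)))) := by
  exact theorem2_general H hH AL A hAL hAL'
    (fun X hX ↦ hA (BooleanSubalgebra.subset_closure (.inl hX))) σ hσ π hπ
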